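/- Let $d\in\{2,3\}$, $L>0$, $\Omega=(0,L)^d$, $\varepsilon>0$, $\delta>0$, $f(z)=\varepsilon^{-2}(z^3-z)$, and let $r_{\max}\approx 4.8645$ be the real root of $x^3=(2x+1)^2$. Write $(u,v)=\int_\Omega u\bar v\,dx$, let $\|\cdot\|$ be the norm of $L^2(\Omega)$, put $\|u\|_{H^2}^2=\|u\|^2+\sum_i\|\partial_iu\|^2+\sum_{i,j}\|\partial_i\partial_ju\|^2$ and $$E(u)=\int_\Omega\Big(\tfrac12|\nabla u|^2+\tfrac1{4\varepsilon^2}|u^2-1|^2\Big)dx .$$ Let $\Phi^0\in H^4_{per}(\Omega)$ be real-valued. For an integer $N\ge2$ let $S_N$ be the span of the functions $x\mapsto e^{2\pi i\,k\cdot x/L}$ with $k\in\mathbb Z^d$ and $-N/2\le k_j\le N/2-1$ for all $j$, where either all complex linear combinations are taken, or only the real-valued ones (the claim holds for both choices). Let $P_N$ be the $L^2(\Omega)$-orthogonal projection to $S_N$. Let $0=t_0<t_1<\dots<t_K=T$, $\tau_k=t_k-t_{k-1}$, $r_1=0$, and $r_k=\tau_k/\tau_{k-1}$ for $2\le k\le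 K$, and assume $$\textbf{A1}:\qquad 0<r_k\le r_{\max}-\delta,\qquad 2\le k\le K.$$ Let $\mathcal D_2u^n=\frac{1+2r_n}{\tau_n(1+r_n)}(u^n-u^{n-1})-\frac{r_n^2}{\tau_n(1+r_n)}(u^{n-1}-u^{n-2})$ for $n\ge2$, $\mathcal D_2u^1=\frac{1}{\tau_1}(u^1-u^0)$, $Bu^0=u^0$, and $Bu^{n-1}=(1+r_n)u^{n-1}-r_nu^{n-2}$ for $n\ge2$. Let $\bar\phi^n\in S_N$, $\phi^n\in S_N$ and $\gamma^n,\xi^n,\eta^n\in\mathbb R$ satisfy $\bar\phi^0=\phi^0=P_N\Phi^0$, $\gamma^0=E(\phi^0)+1$ and, for $1\le n\le K$, $$(\mathcal D_2\bar\phi^n,v)+(\Delta^2\bar\phi^n,v)-(\Delta f(B\phi^{n-1}),v)=0\quad\text{for all } v\in S_N,$$ $$\frac{\gamma^n-\gamma^{n-1}}{\tau_n}=-\frac{\gamma^n}{E(\bar\phi^n)+1}\,\big\|-\nabla\Delta\bar\phi^n+\nabla f(B\phi^{n-1})\big\|^2,$$ $$\xi^n=\frac{\gamma^n}{E(\bar\phi^n)+1},\qquad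 \eta^n=1-(1-\xi^n)^2,\qquad \phi^n=\eta^n\bar\phi^n .$$ Then for all $1\le n\le K$ $$\|\bar\phi^n\|_{H^2}\le\tilde M_0\qquad\text{and}\qquad \|\phi^n\|_{H^2}=\|\eta^n\bar\phi^n\|_{H^2}\le\gamma^0(2+\gamma^0)\tilde M_0=:\tilde M,$$ $$\|f(B\phi^{n-1})\|_{L^\infty},\ \|f'(B\phi^{n-1})\|_{L^\infty},\ \|f''(B\phi^{n-1})\|_{L^\infty}\ \le\ \bar g(\tilde M),$$ where $$\bar g(x)=[(1+2r_{\max})x]^3+3[(1+2r_{\max})x]^2+6[(1+2r_{\max})x]+1 .$$ Here $\tilde M_0$ depends only on $\Phi^0,\Omega,\varepsilon,\delta,r_{\max}$ and $t_n$, and $\tilde M$ is bounded by a constant that depends only on these quantities. In particular the bounds are uniform in $N$, in the time mesh and in $T$. -/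

import Mathlib

open MeasureTheory
open scoped ENNReal

noncomputable section

namespace CahnHilliard

/-! ### The cell `Ω = (0, L)^d`, derivatives, norms and the periodic Sobolev spaces -/

/-- The open periodic cell `Ω = (0, L)^d`. -/
def cell (d : ℕ) (L : ℝ) : Set (Fin d → ℝ) := Set.univ.pi fun _ => Set.Ioo 0 L

/-- Lebesgue measure on `Ω`. -/
def cellMeasure (d : ℕ) (L : ℝ) : Measure (Fin d → ℝ) := volume.restrict (cell d L)

/-- The partial derivative `∂ᵢ u`. -/
def pderiv {d : ℕ} (i : Fin d) (u : (Fin d → ℝ) → ℂ) : (Fin d → ℝ) → ℂ :=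
  fun x => lineDeriv ℝ u x (Pi.single i 1)

/-- The Laplacian `Δ u = ∑ᵢ ∂ᵢ ∂ᵢ u`. -/
def lap {d : ℕ} (u : (Fin d → ℝ) → ℂ) : (Fin d → ℝ) → ℂ :=
  fun x => ∑ i, pderiv i (pderiv i u) x

/-- The inner product `(u, v) = ∫_Ω u v̄` of `L²(Ω)`. -/
def inner2 {d : ℕ} (L : ℝ) (u v : (Fin d → ℝ) → ℂ) : ℂ :=
  ∫ x, u x * (starRingEnd ℂ) (v x) ∂(cellMeasure d L)

/-- The squared norm `‖u‖² = ∫_Ω |u|²` of `L²(Ω)`. -/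
def normSq2 {d : ℕ} (L : ℝ) (u : (Fin d → ℝ) → ℂ) : ℝ :=
  ∫ x, ‖u x‖ ^ 2 ∂(cellMeasure d L)

/-- The squared norm `‖∇ u‖² = ∑ᵢ ‖∂ᵢ u‖²`. -/
def gradNormSq {d : ℕ} (L : ℝ) (u : (Fin d → ℝ) → ℂ) : ℝ :=
  ∑ i, normSq2 L (pderiv i u)

/-- The norm of `H²(Ω)` (of a smooth function):
`‖u‖_{H²}² = ‖u‖² + ∑ᵢ ‖∂ᵢ u‖² + ∑ᵢⱼ ‖∂ᵢ ∂ⱼ u‖²`. -/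
def normH2 {d : ℕ} (L : ℝ) (u : (Fin d → ℝ) → ℂ) : ℝ :=
  Real.sqrt (normSq2 L u + gradNormSq L u + ∑ i, ∑ j, normSq2 L (pderiv i (pderiv j u)))

/-- The (possibly infinite) norm of `L^∞(Ω)`. -/
def normLinf {d : ℕ} (L : ℝ) (u : (Fin d → ℝ) → ℂ) : ℝ≥0∞ :=
  eLpNorm u ∞ (cellMeasure d L)

/-- The iterated partial derivative `∂_{i₁} ⋯ ∂_{iₘ} u` along a list of directions. -/
def iterPDeriv {d : ℕ} (l : List (Fin d)) (u : (Fin d → ℝ) → ℂ) : (Fin d → ℝ) → ℂ :=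
  l.foldr pderiv u

/-- Smooth functions on `ℝ^d` that are `L`-periodic in every coordinate. -/
def IsPeriodicTest {d : ℕ} (L : ℝ) (ψ : (Fin d → ℝ) → ℂ) : Prop :=
  ContDiff ℝ (⊤ : ℕ∞) ψ ∧ ∀ (i : Fin d) (x : Fin d → ℝ), ψ (x + Pi.single i L) = ψ x

/-- `g` is the weak derivative of `u` on the periodic cell along the directions in `l`:
`∫_Ω u ∂^l ψ = (-1)^{|l|} ∫_Ω g ψ` for all smooth periodic `ψ`. Testing with periodic functions
(not only compactly supported ones) encodes that the traces on opposite faces match. -/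
def IsWeakPeriodicDeriv {d : ℕ} (L : ℝ) (l : List (Fin d)) (u g : (Fin d → ℝ) → ℂ) : Prop :=
  ∀ ψ, IsPeriodicTest L ψ →
    ∫ x, u x * iterPDeriv l ψ x ∂(cellMeasure d L)
      = (-1) ^ l.length * ∫ x, g x * ψ x ∂(cellMeasure d L)

/-- The periodic Sobolev space `H^m_per(Ω)`: `u ∈ L²(Ω)`, and all weak derivatives of order at
most `m` on the periodic cell exist in `L²(Ω)`. -/
def MemHper {d : ℕ} (m : ℕ) (L : ℝ) (u : (Fin d → ℝ) → ℂ) : Prop :=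
  MemLp u 2 (cellMeasure d L) ∧
    ∀ l : List (Fin d), l.length ≤ m →
      ∃ g, MemLp g 2 (cellMeasure d L) ∧ IsWeakPeriodicDeriv L l u g

/-! ### The Fourier spaces and the projection -/

/-- The Fourier mode `x ↦ exp (i ∑ⱼ (2π kⱼ / L) xⱼ)`. -/
def fourierMode {d : ℕ} (L : ℝ) (k : Fin d → ℤ) : (Fin d → ℝ) → ℂ :=
  fun x => Complex.exp (Complex.I * ((∑ j, 2 * Real.pi * (k j : ℝ) / L * x j : ℝ) : ℂ))

/-- The Fourier space `S_N`, the complex span of the modes with `-N/2 ≤ kⱼ ≤ N/2 - 1`. -/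
def fourierSpace (d N : ℕ) (L : ℝ) : Submodule ℂ ((Fin d → ℝ) → ℂ) :=
  Submodule.span ℂ
    {u | ∃ k : Fin d → ℤ,
      (∀ j, -(N : ℝ) / 2 ≤ (k j : ℝ) ∧ (k j : ℝ) ≤ (N : ℝ) / 2 - 1) ∧ u = fourierMode L k}

/-- The real-valued functions in `S_N`. -/
def realFourierSpace (d N : ℕ) (L : ℝ) : Set ((Fin d → ℝ) → ℂ) :=
  {u | u ∈ fourierSpace d N L ∧ ∀ x, (u x).im = 0}

/-- `p` is the `L²`-orthogonal projection of `u` to `V`: `p ∈ V` and `(p - u, v) = 0` for all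
`v ∈ V`. -/
def IsL2Proj {d : ℕ} (L : ℝ) (V : Set ((Fin d → ℝ) → ℂ)) (u p : (Fin d → ℝ) → ℂ) : Prop :=
  p ∈ V ∧ ∀ v ∈ V, inner2 L (p - u) v = 0

/-! ### The nonlinearity and the energy -/

/-- `f(z) = (z³ - z) / ε²`. -/
def nonlin (ε : ℝ) (z : ℂ) : ℂ := 1 / (ε : ℂ) ^ 2 * (z ^ 3 - z)

/-- The energy `E[u] = ∫_Ω (|∇u|² / 2 + |u² - 1|² / (4 ε²))`. -/
def energy {d : ℕ} (L ε : ℝ) (u : (Fin d → ℝ) → ℂ) : ℝ :=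
  ∫ x, (1 / 2 * ∑ i, ‖pderiv i u x‖ ^ 2 + ‖u x ^ 2 - 1‖ ^ 2 / (4 * ε ^ 2)) ∂(cellMeasure d L)

/-! ### Time mesh, the ratio restriction, BDF2 and extrapolation -/

/-- `0 = t₀ < t₁ < ⋯ < t_K`. -/
def IsMesh (K : ℕ) (t : ℕ → ℝ) : Prop := t 0 = 0 ∧ ∀ k < K, t k < t (k + 1)

/-- The time step `τₖ = tₖ - tₖ₋₁` (for `k ≥ 1`). -/
def step (t : ℕ → ℝ) (k : ℕ) : ℝ := t k - t (k - 1)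

/-- The ratio `rₖ = τₖ / τₖ₋₁` for `k ≥ 2`, and `r₁ = 0`. -/
def ratio (t : ℕ → ℝ) (k : ℕ) : ℝ := if k ≤ 1 then 0 else step t k / step t (k - 1)

theorem existsUnique_root : ∃! x : ℝ, x ^ 3 = (2 * x + 1) ^ 2 := by
  have hc : ContinuousOn (fun x : ℝ => x ^ 3 - (2 * x + 1) ^ 2) (Set.Icc 4 5) := by fun_prop
  have h0 : (0 : ℝ) ∈ (fun x : ℝ => x ^ 3 - (2 * x + 1) ^ 2) '' Set.Icc 4 5 := by
    apply intermediate_value_Icc (by norm_num) hc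
    constructor <;> norm_num
  obtain ⟨a, ⟨ha4, _⟩, ha⟩ := h0
  simp only at ha
  refine ⟨a, by linarith, ?_⟩
  intro y hy
  by_contra hne
  have hf : (y - a) * (y ^ 2 + (a - 4) * y + (a ^ 2 - 4 * a - 4)) = 0 := by
    linear_combination hy - ha
  have h2 : y ^ 2 + (a - 4) * y + (a ^ 2 - 4 * a - 4) = 0 := by
    rcases mul_eq_zero.1 hf with h | h
    · exact absurd (sub_eq_zero.1 h) hne
    · exact h
  have ha5 : 4.8 < a := by
    by_contra hlt
    push Not at hlt
    nlinarith [mul_nonneg (sub_nonneg.2 ha4) (sub_nonneg.2 hlt)]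
  nlinarith [sq_nonneg (2 * y + (a - 4)), mul_pos (sub_pos.2 ha5) (sub_pos.2 ha5)]

/-- `r_max ≈ 4.8645`, the real root of `x³ = (2x + 1)²`. -/
def rMax : ℝ := existsUnique_root.choose

theorem rMax_spec : rMax ^ 3 = (2 * rMax + 1) ^ 2 := existsUnique_root.choose_spec.1

/-- The ratio restriction `0 < rₖ ≤ r_max - δ` for `2 ≤ k ≤ K`. -/
def RatioCondition (δ : ℝ) (K : ℕ) (t : ℕ → ℝ) : Prop :=
  ∀ k, 2 ≤ k → k ≤ K → 0 < ratio t k ∧ ratio t k ≤ rMax - δ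

/-- The kernel `b_j^{(n)}`. -/
def bdfKernel (t : ℕ → ℝ) (n j : ℕ) : ℝ :=
  if j = 0 then (1 + 2 * ratio t n) / (step t n * (1 + ratio t n))
  else if j = 1 then -(ratio t n ^ 2 / (step t n * (1 + ratio t n)))
  else 0

/-- `𝒟₂ uⁿ = ∑_{k=1}^n b_{n-k}^{(n)} (uᵏ - uᵏ⁻¹)`; for `n = 1` this is BDF1. -/
def bdf2 {d : ℕ} (t : ℕ → ℝ) (u : ℕ → (Fin d → ℝ) → ℂ) (n : ℕ) : (Fin d → ℝ) → ℂ :=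
  ∑ k ∈ Finset.Icc 1 n, bdfKernel t n (n - k) • (u k - u (k - 1))

/-- `extrap t u n` is `B uⁿ⁻¹` (for `n ≥ 1`): `B u⁰ = u⁰`, and
`B uⁿ⁻¹ = (1 + rₙ) uⁿ⁻¹ - rₙ uⁿ⁻²` for `n ≥ 2`. -/
def extrap {d : ℕ} (t : ℕ → ℝ) (u : ℕ → (Fin d → ℝ) → ℂ) (n : ℕ) : (Fin d → ℝ) → ℂ :=
  if n ≤ 1 then u 0 else (1 + ratio t n) • u (n - 1) - ratio t n • u (n - 2)

/-! ### The scheme -/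

/-- `(φb, γ, ξ, η, φ)` solves, on the mesh `t₀ < ⋯ < t_K`, the fully discrete scheme with trial
and test space `V` and initial value `Φ0`. Here `φb` stands for `φ̄`. -/
structure IsSchemeSolution {d : ℕ} (L ε : ℝ) (V : Set ((Fin d → ℝ) → ℂ))
    (Φ0 : (Fin d → ℝ) → ℂ) (K : ℕ) (t : ℕ → ℝ)
    (φb φ : ℕ → (Fin d → ℝ) → ℂ) (γ ξ η : ℕ → ℝ) : Prop where
  /-- `φ̄⁰ = P_N Φ⁰` -/
  init_proj : IsL2Proj L V Φ0 (φb 0)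
  /-- `φ⁰ = φ̄⁰` -/
  init_eq : φ 0 = φb 0
  /-- `γ⁰ = E(φ⁰) + 1` -/
  init_energy : γ 0 = energy L ε (φ 0) + 1
  mem : ∀ n, 1 ≤ n → n ≤ K → φb n ∈ V
  /-- `(𝒟₂ φ̄ⁿ, v) + (Δ² φ̄ⁿ, v) - (Δ f(Bφⁿ⁻¹), v) = 0` for all `v ∈ V` -/
  evolution : ∀ n, 1 ≤ n → n ≤ K → ∀ v ∈ V,
    inner2 L (bdf2 t φb n) v + inner2 L (lap (lap (φb n))) v
      - inner2 L (lap fun x => nonlin ε (extrap t φ n x)) v = 0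
  /-- `(γⁿ - γⁿ⁻¹) / τₙ = - γⁿ / (E(φ̄ⁿ) + 1) ‖-∇Δφ̄ⁿ + ∇f(Bφⁿ⁻¹)‖²` -/
  aux : ∀ n, 1 ≤ n → n ≤ K →
    (γ n - γ (n - 1)) / step t n =
      -(γ n / (energy L ε (φb n) + 1)) *
        ∑ i, normSq2 L (fun x =>
          -pderiv i (lap (φb n)) x + pderiv i (fun y => nonlin ε (extrap t φ n y)) x)
  /-- `ξⁿ = γⁿ / (E(φ̄ⁿ) + 1)` -/
  xi_eq : ∀ n, 1 ≤ n → n ≤ K → ξ n = γ n / (energy L ε (φb n) + 1)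
  /-- `ηⁿ = 1 - (1 - ξⁿ)²` -/
  eta_eq : ∀ n, 1 ≤ n → n ≤ K → η n = 1 - (1 - ξ n) ^ 2
  /-- `φⁿ = ηⁿ φ̄ⁿ` -/
  phi_eq : ∀ n, 1 ≤ n → n ≤ K → φ n = η n • φb n

/-- `ḡ(x) = [(1+2r_max)x]³ + 3[(1+2r_max)x]² + 6[(1+2r_max)x] + 1`. -/
def gBar (x : ℝ) : ℝ :=
  ((1 + 2 * rMax) * x) ^ 3 + 3 * ((1 + 2 * rMax) * x) ^ 2 + 6 * ((1 + 2 * rMax) * x) + 1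

end CahnHilliard

end

noncomputable section

namespace CahnHilliard

/-! On the trial space every function is a trigonometric polynomial, and Parseval turns all norms
into the weighted coefficient sums `sob`. Every constant below is independent of the finite
frequency set and of the mesh. Three a priori bounds are stacked.

Bound in H¹. The auxiliary equation forces `0 < γⁿ ≤ γ⁰` and `∑ τ ξ D ≤ γ⁰`, where `D` is the
squared norm of `-∇Δφ̄ⁿ + ∇f(Bφⁿ⁻¹)`. Since `ξ (E(φ̄ⁿ) + 1) = γⁿ` and `|η| ≤ (2 + γ⁰) ξ`, also `η² ≤
C ξ`. The energy controls the H¹ norm, so `‖φⁿ‖²_{H¹} = η² ‖φ̄ⁿ‖²_{H¹}` is at most `C ξ (E + 1)`,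
hence bounded for all times (`sob_one_coef_le`).

Integrated bound in H³. By the same token `η² D ≤ C ξ D` is summable in time, so `∇Δφⁿ = η ∇Δφ̄ⁿ` is
controlled up to `∇f(Bφⁿ⁻¹)`. Given the H¹ bound, `d < 4` and interpolation make `‖∇f(Bφⁿ⁻¹)‖²` an
arbitrarily small multiple of the squared H³ norm of `Bφⁿ⁻¹` plus a constant
(`exists_gradNormSq_nonlin_le`). Bounded step ratios allow these delayed terms to be absorbed, and
`∑ τ ‖Bφⁿ⁻¹‖²_{H³}` grows at most linearly in time (`exists_sum_sob_three_le`).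

Bound in H². The equation is tested with `φ̄ⁿ - φ̄ⁿ⁻¹`. The ratio restriction makes the BDF2 form
positive up to a telescoping term (`exists_bdf_const`, `bdf2_step_estimate`). The forcing satisfies
`‖Δf(u)‖² ≤ C (1 + ‖u‖²_{H³}) ‖u‖²_{H²}`, and a discrete Gronwall inequality applies with weights `τ
(1 + ‖Bφⁿ⁻¹‖²_{H³})`, whose sum is bounded by the previous stage (`exists_sob_two_le`).

The initial value enters through an H⁴ bound for its projection that is uniform in the trial space
(`exists_sob_four_le`). The bounds on the nonlinearity follow from the Sobolev embedding once `M₀`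
is enlarged to absorb the embedding constant and `ε⁻²`. -/

/-- The `i`-th component `2π kᵢ / L` of the frequency of the mode `k`. -/
def freq {d : ℕ} (L : ℝ) (k : Fin d → ℤ) (i : Fin d) : ℝ := 2 * Real.pi * (k i : ℝ) / L

/-- The square of the length of the frequency of the mode `k`. -/
def freqSq {d : ℕ} (L : ℝ) (k : Fin d → ℤ) : ℝ := ∑ i, freq L k i ^ 2

/-- The trigonometric polynomial with frequencies in `S` and coefficients `c`. -/
def trig {d : ℕ} (L : ℝ) (S : Finset (Fin d → ℤ)) (c : (Fin d → ℤ) → ℂ) : (Fin d → ℝ) → ℂ :=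
  fun x => ∑ k ∈ S, c k * fourierMode L k x

/-- The squared Sobolev norm of order `m` of a trigonometric polynomial in terms of its
coefficients (up to the volume of the cell). -/
def sob {d : ℕ} (L : ℝ) (S : Finset (Fin d → ℤ)) (m : ℕ) (c : (Fin d → ℤ) → ℂ) : ℝ :=
  ∑ k ∈ S, (1 + freqSq L k) ^ m * ‖c k‖ ^ 2

/-! ### Derivatives of trigonometric polynomials -/

section Basic

variable {d : ℕ} {L : ℝ} {S : Finset (Fin d → ℤ)}

theorem freqSq_nonneg (L : ℝ) (k : Fin d → ℤ) : 0 ≤ freqSq L k :=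
  Finset.sum_nonneg fun _ _ => sq_nonneg _

theorem sob_nonneg (L : ℝ) (S : Finset (Fin d → ℤ)) (m : ℕ) (c : (Fin d → ℤ) → ℂ) :
    0 ≤ sob L S m c :=
  Finset.sum_nonneg fun k _ => by have := freqSq_nonneg L k; positivity

theorem fourierMode_eq (k : Fin d → ℤ) (x : Fin d → ℝ) :
    fourierMode L k x = Complex.exp (Complex.I * ((∑ j, freq L k j * x j : ℝ) : ℂ)) := rfl

theorem norm_fourierMode (k : Fin d → ℤ) (x : Fin d → ℝ) : ‖fourierMode L k x‖ = 1 := by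
  rw [fourierMode, mul_comm, Complex.norm_exp_ofReal_mul_I]

theorem contDiff_fourierMode (k : Fin d → ℤ) : ContDiff ℝ (⊤ : ℕ∞) (fourierMode L k) := by
  have h : ContDiff ℝ (⊤ : ℕ∞) fun x : Fin d → ℝ => ∑ j, 2 * Real.pi * (k j : ℝ) / L * x j :=
    ContDiff.sum fun j _ => by fun_prop
  exact ContDiff.cexp (contDiff_const.mul (Complex.ofRealCLM.contDiff.comp h))

theorem contDiff_trig (c : (Fin d → ℤ) → ℂ) : ContDiff ℝ (⊤ : ℕ∞) (trig L S c) :=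
  ContDiff.sum fun k _ => contDiff_const.mul (contDiff_fourierMode k)

theorem continuous_trig (c : (Fin d → ℤ) → ℂ) : Continuous (trig L S c) :=
  (contDiff_trig c).continuous

theorem differentiable_trig (c : (Fin d → ℤ) → ℂ) : Differentiable ℝ (trig L S c) :=
  (contDiff_trig c).differentiable (by simp)

theorem hasLineDerivAt_fourierMode (i : Fin d) (k : Fin d → ℤ) (x : Fin d → ℝ) :
    HasLineDerivAt ℝ (fourierMode L k) (Complex.I * freq L k i * fourierMode L k x) x
      (Pi.single i 1) := by
  have h : HasDerivAt (fun s : ℝ => ∑ j, freq L k j * (x + s • (Pi.single i (1 : ℝ) : Fin d → ℝ)) j)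
      (freq L k i) 0 := by
    have : (fun s : ℝ => ∑ j, freq L k j * (x + s • (Pi.single i (1 : ℝ) : Fin d → ℝ)) j)
        = fun s => (∑ j, freq L k j * x j) + s * freq L k i := by
      funext s
      simp [mul_add, Finset.sum_add_distrib, Pi.single_apply, mul_comm]
    rw [this]
    simpa using ((hasDerivAt_id (0 : ℝ)).mul_const (freq L k i)).const_add
      (∑ j, freq L k j * x j)
  have h2 := ((h.ofReal_comp).const_mul Complex.I).cexp
  unfold HasLineDerivAt
  refine h2.congr_deriv ?_
  rw [fourierMode_eq]
  simp only [zero_smul, add_zero]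
  ring

theorem pderiv_trig (i : Fin d) (c : (Fin d → ℤ) → ℂ) :
    pderiv i (trig L S c) = trig L S (fun k => Complex.I * freq L k i * c k) := by
  funext x
  have : HasLineDerivAt ℝ (trig L S c)
      (∑ k ∈ S, c k * (Complex.I * freq L k i * fourierMode L k x)) x (Pi.single i 1) := by
    unfold HasLineDerivAt trig
    exact HasDerivAt.fun_sum fun k _ => (hasLineDerivAt_fourierMode i k x).const_mul (c k)
  rw [pderiv, this.lineDeriv, trig]
  exact Finset.sum_congr rfl fun k _ => by ring

theorem pderiv_pderiv_trig (i j : Fin d) (c : (Fin d → ℤ) → ℂ) :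
    pderiv i (pderiv j (trig L S c)) = trig L S (fun k => -(freq L k i * freq L k j : ℝ) * c k) := by
  rw [pderiv_trig, pderiv_trig]
  congr 1
  funext k
  push_cast
  linear_combination (freq L k i * freq L k j * c k : ℂ) * Complex.I_sq

theorem lap_trig (c : (Fin d → ℤ) → ℂ) :
    lap (trig L S c) = trig L S (fun k => -(freqSq L k : ℝ) * c k) := by
  funext x
  simp only [lap, pderiv_pderiv_trig, trig]
  rw [Finset.sum_comm]
  refine Finset.sum_congr rfl fun k _ => ?_
  rw [← Finset.sum_mul, ← Finset.sum_mul, freqSq]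
  simp [sq]

theorem trig_add (a b : (Fin d → ℤ) → ℂ) : trig L S (a + b) = trig L S a + trig L S b := by
  funext x; simp [trig, add_mul, Finset.sum_add_distrib]

theorem trig_sub (a b : (Fin d → ℤ) → ℂ) : trig L S (a - b) = trig L S a - trig L S b := by
  funext x; simp [trig, sub_mul]

theorem trig_smul (r : ℝ) (a : (Fin d → ℤ) → ℂ) : trig L S (r • a) = r • trig L S a := by
  funext x; simp [trig, Finset.mul_sum, mul_assoc]

theorem fourierMode_periodic (hL : L ≠ 0) (k : Fin d → ℤ) (i : Fin d) (x : Fin d → ℝ) :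
    fourierMode L k (x + Pi.single i L) = fourierMode L k x := by
  have : ∑ j, freq L k j * (x + Pi.single i L : Fin d → ℝ) j
      = (∑ j, freq L k j * x j) + 2 * Real.pi * k i := by
    simp only [Pi.add_apply, mul_add, Finset.sum_add_distrib, Pi.single_apply, mul_ite, mul_zero,
      Finset.sum_ite_eq', Finset.mem_univ, if_true, freq]
    field_simp
  rw [fourierMode_eq, this, fourierMode_eq, Complex.exp_eq_exp_iff_exists_int]
  exact ⟨k i, by push_cast; ring⟩

theorem trig_periodic (hL : L ≠ 0) (c : (Fin d → ℤ) → ℂ) (i : Fin d) (x : Fin d → ℝ) :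
    trig L S c (x + Pi.single i L) = trig L S c x := by
  simp only [trig, fourierMode_periodic hL]

theorem norm_trig_le (c : (Fin d → ℤ) → ℂ) (x : Fin d → ℝ) :
    ‖trig L S c x‖ ≤ ∑ k ∈ S, ‖c k‖ := by
  refine (norm_sum_le _ _).trans (Finset.sum_le_sum fun k _ => ?_)
  rw [norm_mul, norm_fourierMode, mul_one]

/-! ### Integration over the cell -/

theorem cellMeasure_eq_pi (d : ℕ) (L : ℝ) :
    cellMeasure d L = Measure.pi fun _ : Fin d => (volume : Measure ℝ).restrict (Set.Ioo 0 L) := by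
  rw [cellMeasure, cell, volume_pi, Measure.restrict_pi_pi]

instance (d : ℕ) (L : ℝ) : IsFiniteMeasure (cellMeasure d L) := by
  rw [cellMeasure_eq_pi]; infer_instance

theorem cellMeasure_real_univ (hL : 0 < L) : (cellMeasure d L).real Set.univ = L ^ d := by
  rw [cellMeasure_eq_pi, Measure.real, Measure.pi_univ]
  simp [hL.le, ENNReal.toReal_ofReal]

theorem integrable_of_continuous {E : Type*} [NormedAddCommGroup E] {u : (Fin d → ℝ) → E}
    (hu : Continuous u) : Integrable u (cellMeasure d L) := by
  have h : IntegrableOn u (Set.univ.pi fun _ : Fin d => Set.Icc 0 L) volume :=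
    hu.continuousOn.integrableOn_compact (isCompact_univ_pi fun _ => isCompact_Icc)
  exact h.mono_set (Set.pi_mono fun _ _ => Set.Ioo_subset_Icc_self)

theorem integral_Ioo_exp (hL : 0 < L) (m : ℤ) :
    ∫ y in Set.Ioo 0 L, Complex.exp (Complex.I * ((2 * Real.pi * (m : ℝ) / L * y : ℝ) : ℂ))
      = if m = 0 then (L : ℂ) else 0 := by
  split_ifs with hm
  · subst hm
    simp [hL.le]
  · rw [← integral_Ioc_eq_integral_Ioo, ← intervalIntegral.integral_of_le hL.le]
    have hL' : (L : ℂ) ≠ 0 := by exact_mod_cast hL.ne'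
    have hc : Complex.I * (2 * Real.pi * m / L : ℂ) ≠ 0 := by
      have : (m : ℂ) ≠ 0 := by exact_mod_cast hm
      have hpi : (Real.pi : ℂ) ≠ 0 := by exact_mod_cast Real.pi_ne_zero
      exact mul_ne_zero Complex.I_ne_zero (div_ne_zero (by simp [*]) hL')
    have := integral_exp_mul_complex (a := 0) (b := L) hc
    have h1 : Complex.exp (Complex.I * (2 * Real.pi * m / L : ℂ) * (L : ℂ)) = 1 := by
      rw [Complex.exp_eq_one_iff]
      exact ⟨m, by field_simp⟩
    rw [h1] at this
    simp only [Complex.ofReal_zero, mul_zero, Complex.exp_zero, sub_self, zero_div] at this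
    rw [← this]
    congr 1
    funext y
    push_cast
    ring_nf

theorem inner2_fourierMode (hL : 0 < L) (k l : Fin d → ℤ) :
    inner2 L (fourierMode L k) (fourierMode L l) = if k = l then (L : ℂ) ^ d else 0 := by
  have h : ∀ x : Fin d → ℝ, fourierMode L k x * (starRingEnd ℂ) (fourierMode L l x)
      = ∏ j, Complex.exp (Complex.I * ((2 * Real.pi * ((k j - l j : ℤ) : ℝ) / L * x j : ℝ) : ℂ)) := by
    intro x
    rw [← Complex.exp_sum, fourierMode, fourierMode, ← Complex.exp_conj, ← Complex.exp_add]
    congr 1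
    simp only [map_mul, Complex.conj_I, Complex.conj_ofReal]
    rw [← Finset.mul_sum, neg_mul, ← sub_eq_add_neg, ← mul_sub]
    congr 1
    rw [← Complex.ofReal_sub, ← Finset.sum_sub_distrib, ← Complex.ofReal_sum]
    congr 1
    refine Finset.sum_congr rfl fun j _ => ?_
    push_cast
    ring
  rw [inner2]
  simp only [h]
  rw [cellMeasure_eq_pi, integral_fintype_prod_eq_prod (𝕜 := ℂ)
    (f := fun j (y : ℝ) => Complex.exp
      (Complex.I * ((2 * Real.pi * ((k j - l j : ℤ) : ℝ) / L * y : ℝ) : ℂ)))]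
  simp only [integral_Ioo_exp hL]
  split_ifs with hkl
  · simp [hkl]
  · obtain ⟨j, hj⟩ := Function.ne_iff.1 hkl
    exact Finset.prod_eq_zero (Finset.mem_univ j) (if_neg (sub_ne_zero.2 hj))

/-- Parseval: distinct modes are orthogonal on the cell, so only the diagonal of the double sum
survives. -/
theorem inner2_trig (hL : 0 < L) (a b : (Fin d → ℤ) → ℂ) :
    inner2 L (trig L S a) (trig L S b) = (L : ℂ) ^ d * ∑ k ∈ S, a k * (starRingEnd ℂ) (b k) := by
  have hc : ∀ k : Fin d → ℤ, Continuous (fourierMode L k) := fun k =>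
    (contDiff_fourierMode k).continuous
  have h : ∀ x, trig L S a x * (starRingEnd ℂ) (trig L S b x)
      = ∑ k ∈ S, ∑ l ∈ S, (a k * (starRingEnd ℂ) (b l)) *
        (fourierMode L k x * (starRingEnd ℂ) (fourierMode L l x)) := by
    intro x
    rw [trig, trig, map_sum, Finset.sum_mul_sum]
    refine Finset.sum_congr rfl fun k _ => Finset.sum_congr rfl fun l _ => ?_
    rw [map_mul]; ring
  rw [inner2]
  simp only [h]
  have hint : ∀ k l : Fin d → ℤ, Integrable (fun x => (a k * (starRingEnd ℂ) (b l)) *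
        (fourierMode L k x * (starRingEnd ℂ) (fourierMode L l x))) (cellMeasure d L) :=
    fun k l => integrable_of_continuous
      (continuous_const.mul ((hc k).mul (Complex.continuous_conj.comp (hc l))))
  rw [integral_finsetSum _ fun k _ => integrable_finsetSum _ fun l _ => hint k l, Finset.mul_sum]
  refine Finset.sum_congr rfl fun k hk => ?_
  rw [integral_finsetSum _ fun l _ => hint k l]
  simp only [integral_const_mul]
  have : ∀ l, ∫ x, fourierMode L k x * (starRingEnd ℂ) (fourierMode L l x) ∂(cellMeasure d L)
      = if k = l then (L : ℂ) ^ d else 0 := fun l => inner2_fourierMode hL k l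
  simp only [this, mul_ite, mul_zero, Finset.sum_ite_eq, hk, if_true]
  ring

theorem inner2_self (u : (Fin d → ℝ) → ℂ) : inner2 L u u = (normSq2 L u : ℂ) := by
  rw [inner2, normSq2, ← integral_complex_ofReal]
  simp [Complex.mul_conj, Complex.normSq_eq_norm_sq]

theorem normSq2_trig (hL : 0 < L) (c : (Fin d → ℤ) → ℂ) :
    normSq2 L (trig L S c) = L ^ d * ∑ k ∈ S, ‖c k‖ ^ 2 := by
  have h := inner2_trig (S := S) hL c c
  rw [inner2_self] at h
  have h2 : ∀ k, c k * (starRingEnd ℂ) (c k) = ((‖c k‖ ^ 2 : ℝ) : ℂ) := by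
    simp [Complex.mul_conj, Complex.normSq_eq_norm_sq]
  simp only [h2] at h
  exact_mod_cast h

theorem gradNormSq_trig (hL : 0 < L) (c : (Fin d → ℤ) → ℂ) :
    gradNormSq L (trig L S c) = L ^ d * ∑ k ∈ S, freqSq L k * ‖c k‖ ^ 2 := by
  simp only [gradNormSq, pderiv_trig, normSq2_trig hL]
  rw [← Finset.mul_sum, Finset.sum_comm]
  congr 1
  refine Finset.sum_congr rfl fun k _ => ?_
  simp [freqSq, Finset.sum_mul, mul_pow]

theorem normSq2_lap_trig (hL : 0 < L) (c : (Fin d → ℤ) → ℂ) :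
    normSq2 L (lap (trig L S c)) = L ^ d * ∑ k ∈ S, freqSq L k ^ 2 * ‖c k‖ ^ 2 := by
  simp [lap_trig, normSq2_trig hL, mul_pow]

theorem gradNormSq_lap_trig (hL : 0 < L) (c : (Fin d → ℤ) → ℂ) :
    gradNormSq L (lap (trig L S c)) = L ^ d * ∑ k ∈ S, freqSq L k ^ 3 * ‖c k‖ ^ 2 := by
  rw [lap_trig, gradNormSq_trig hL]
  congr 1
  refine Finset.sum_congr rfl fun k _ => ?_
  simp [mul_pow]
  ring

theorem sum_normSq2_pderiv_pderiv_trig (hL : 0 < L) (c : (Fin d → ℤ) → ℂ) :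
    ∑ i, ∑ j, normSq2 L (pderiv i (pderiv j (trig L S c)))
      = L ^ d * ∑ k ∈ S, freqSq L k ^ 2 * ‖c k‖ ^ 2 := by
  simp only [pderiv_pderiv_trig, normSq2_trig hL]
  simp only [← Finset.mul_sum]
  congr 1
  have : ∀ i : Fin d, ∑ j, ∑ k ∈ S, ‖-((freq L k i * freq L k j : ℝ) : ℂ) * c k‖ ^ 2
      = ∑ k ∈ S, ∑ j, ‖-((freq L k i * freq L k j : ℝ) : ℂ) * c k‖ ^ 2 := fun i => Finset.sum_comm
  simp only [this]
  rw [Finset.sum_comm]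
  refine Finset.sum_congr rfl fun k _ => ?_
  rw [freqSq, sq (∑ i, freq L k i ^ 2), Finset.sum_mul_sum, Finset.sum_mul]
  refine Finset.sum_congr rfl fun i _ => ?_
  rw [Finset.sum_mul]
  refine Finset.sum_congr rfl fun j _ => ?_
  simp [mul_pow]

/-! ### Fourier-side Sobolev norms: comparison and interpolation -/

theorem sob_smul (r : ℝ) (m : ℕ) (c : (Fin d → ℤ) → ℂ) :
    sob L S m (r • c) = r ^ 2 * sob L S m c := by
  simp only [sob, Finset.mul_sum, Pi.smul_apply, norm_smul, mul_pow, Real.norm_eq_abs, sq_abs]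
  exact Finset.sum_congr rfl fun k _ => by ring

theorem sob_sub_le (m : ℕ) (a b : (Fin d → ℤ) → ℂ) :
    sob L S m (a - b) ≤ 2 * sob L S m a + 2 * sob L S m b := by
  simp only [sob, Finset.mul_sum]
  rw [← Finset.sum_add_distrib]
  refine Finset.sum_le_sum fun k _ => ?_
  have h1 : ‖(a - b) k‖ ^ 2 ≤ 2 * ‖a k‖ ^ 2 + 2 * ‖b k‖ ^ 2 := by
    have := norm_sub_le (a k) (b k)
    have h0 := norm_nonneg (a k - b k)
    simp only [Pi.sub_apply]
    nlinarith [sq_nonneg (‖a k‖ - ‖b k‖)]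
  have h2 : 0 ≤ (1 + freqSq L k) ^ m := by have := freqSq_nonneg L k; positivity
  nlinarith

theorem sob_mono {m n : ℕ} (h : m ≤ n) (c : (Fin d → ℤ) → ℂ) : sob L S m c ≤ sob L S n c := by
  refine Finset.sum_le_sum fun k _ => ?_
  have := freqSq_nonneg L k
  gcongr
  linarith

/-- Interpolation between H¹ and H³ by Cauchy–Schwarz on the weights. It makes a fourth power of the
sup norm linear in the squared H³ norm once the H¹ norm is bounded. -/
theorem sob_two_sq_le (c : (Fin d → ℤ) → ℂ) : sob L S 2 c ^ 2 ≤ sob L S 1 c * sob L S 3 c := by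
  refine Finset.sum_sq_le_sum_mul_sum_of_sq_le_mul S
    (fun k _ => ?_) (fun k _ => ?_) (fun k _ => ?_)
  · have := freqSq_nonneg L k; positivity
  · have := freqSq_nonneg L k; positivity
  · exact le_of_eq (by ring)

theorem normH2_trig_le (hL : 0 < L) (c : (Fin d → ℤ) → ℂ) :
    normH2 L (trig L S c) ≤ Real.sqrt (L ^ d * sob L S 2 c) := by
  refine Real.sqrt_le_sqrt ?_
  rw [normSq2_trig hL, gradNormSq_trig hL, sum_normSq2_pderiv_pderiv_trig hL, ← mul_add, ← mul_add,
    ← Finset.sum_add_distrib, ← Finset.sum_add_distrib]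
  refine mul_le_mul_of_nonneg_left (Finset.sum_le_sum fun k _ => ?_) (by positivity)
  have := freqSq_nonneg L k
  nlinarith [sq_nonneg ‖c k‖, mul_nonneg this (sq_nonneg ‖c k‖)]

theorem normH2_smul_trig (hL : 0 < L) (r : ℝ) (c : (Fin d → ℤ) → ℂ) :
    normH2 L (r • trig L S c) = |r| * normH2 L (trig L S c) := by
  have h : ∀ g : (Fin d → ℤ) → ℝ, ∑ k ∈ S, g k * ‖(r • c) k‖ ^ 2
      = r ^ 2 * ∑ k ∈ S, g k * ‖c k‖ ^ 2 := by
    intro g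
    rw [Finset.mul_sum]
    refine Finset.sum_congr rfl fun k _ => ?_
    simp only [Pi.smul_apply, norm_smul, mul_pow, Real.norm_eq_abs, sq_abs]
    ring
  have h1 : ∑ k ∈ S, ‖(r • c) k‖ ^ 2 = r ^ 2 * ∑ k ∈ S, ‖c k‖ ^ 2 := by
    simpa using h fun _ => 1
  rw [← trig_smul, normH2, normH2]
  simp only [normSq2_trig hL, gradNormSq_trig hL, sum_normSq2_pderiv_pderiv_trig hL, h, h1]
  rw [← Real.sqrt_sq_eq_abs, ← Real.sqrt_mul (sq_nonneg r)]
  congr 1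
  ring

theorem sob_two_le (hL : 0 < L) (c : (Fin d → ℤ) → ℂ) :
    L ^ d * sob L S 2 c ≤ 2 * (normSq2 L (trig L S c) + normSq2 L (lap (trig L S c))) := by
  rw [normSq2_trig hL, normSq2_lap_trig hL, ← mul_add, mul_left_comm, ← Finset.sum_add_distrib,
    Finset.mul_sum]
  refine mul_le_mul_of_nonneg_left (Finset.sum_le_sum fun k _ => ?_) (by positivity)
  have := freqSq_nonneg L k
  nlinarith [mul_nonneg (sq_nonneg (freqSq L k - 1)) (sq_nonneg ‖c k‖)]

theorem sob_three_le (hL : 0 < L) (c : (Fin d → ℤ) → ℂ) :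
    L ^ d * sob L S 3 c ≤ 4 * (normSq2 L (trig L S c) + gradNormSq L (lap (trig L S c))) := by
  rw [normSq2_trig hL, gradNormSq_lap_trig hL, ← mul_add, mul_left_comm, ← Finset.sum_add_distrib,
    Finset.mul_sum]
  refine mul_le_mul_of_nonneg_left (Finset.sum_le_sum fun k _ => ?_) (by positivity)
  have := freqSq_nonneg L k
  have h : (1 + freqSq L k) ^ 3 ≤ 4 * (1 + freqSq L k ^ 3) := by
    nlinarith [mul_nonneg this (sq_nonneg (freqSq L k - 1)), sq_nonneg (freqSq L k - 1)]
  nlinarith [mul_le_mul_of_nonneg_right h (sq_nonneg ‖c k‖)]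

theorem sob_one_eq (hL : 0 < L) (c : (Fin d → ℤ) → ℂ) :
    L ^ d * sob L S 1 c = normSq2 L (trig L S c) + gradNormSq L (trig L S c) := by
  rw [normSq2_trig hL, gradNormSq_trig hL, ← mul_add, ← Finset.sum_add_distrib]
  congr 1
  exact Finset.sum_congr rfl fun k _ => by ring

theorem normSq2_lap_trig_le (hL : 0 < L) (c : (Fin d → ℤ) → ℂ) :
    normSq2 L (lap (trig L S c)) ≤ L ^ d * sob L S 2 c := by
  rw [normSq2_lap_trig hL]
  refine mul_le_mul_of_nonneg_left (Finset.sum_le_sum fun k _ => ?_) (by positivity)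
  have := freqSq_nonneg L k
  gcongr
  linarith

theorem gradNormSq_trig_le (hL : 0 < L) (c : (Fin d → ℤ) → ℂ) :
    gradNormSq L (trig L S c) ≤ L ^ d * sob L S 1 c := by
  rw [gradNormSq_trig hL]
  refine mul_le_mul_of_nonneg_left (Finset.sum_le_sum fun k _ => ?_) (by positivity)
  have := freqSq_nonneg L k
  gcongr
  linarith

theorem normSq2_trig_eq_sob (hL : 0 < L) (c : (Fin d → ℤ) → ℂ) :
    normSq2 L (trig L S c) = L ^ d * sob L S 0 c := by
  simp [normSq2_trig hL, sob]

/-- Multiplying the coefficients by the `i`-th frequency costs at most one derivative. -/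
theorem sob_freq_mul_le (i : Fin d) (m : ℕ) (c : (Fin d → ℤ) → ℂ) :
    sob L S m (fun k => Complex.I * freq L k i * c k) ≤ sob L S (m + 1) c := by
  refine Finset.sum_le_sum fun k _ => ?_
  have h0 := freqSq_nonneg L k
  have h1 : freq L k i ^ 2 ≤ freqSq L k :=
    Finset.single_le_sum (f := fun i => freq L k i ^ 2) (fun _ _ => sq_nonneg _)
      (Finset.mem_univ i)
  rw [norm_mul, norm_mul, Complex.norm_I, one_mul, mul_pow, Complex.norm_real, Real.norm_eq_abs,
    sq_abs, pow_succ (1 + freqSq L k), mul_assoc]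
  gcongr
  linarith

end Basic

/-! ### The Sobolev inequality -/

/-- Comparison with `∑ ‖k‖⁻⁴` over the integer lattice, which converges because the rank `d` is
below 4. This is where the restriction on the dimension enters. -/
theorem summable_inv_sq_freqSq {d : ℕ} (hd : d < 4) {L : ℝ} (hL : 0 < L) :
    Summable fun k : Fin d → ℤ => ((1 + freqSq L k) ^ 2)⁻¹ := by
  let b := Pi.basisFun ℝ (Fin d)
  let Λ := Submodule.span ℤ (Set.range b)
  have hr : Module.finrank ℤ Λ = d := by
    rw [ZLattice.rank ℝ Λ]; simp
  have hs := ZLattice.summable_norm_pow_inv (L := Λ) 4 (by rw [hr]; exact hd)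
  let e : (Fin d → ℤ) → Λ := fun k => ⟨fun i => (k i : ℝ), by
    have : (fun i => (k i : ℝ)) = ∑ i, k i • b i := by
      funext j; simp [b, Pi.single_apply]
    rw [this]
    exact Submodule.sum_mem _ fun i _ => Submodule.smul_mem _ _ (Submodule.subset_span ⟨i, rfl⟩)⟩
  have he : Function.Injective e := by
    intro k l h
    funext i
    have : ((k i : ℤ) : ℝ) = (l i : ℝ) := congrFun (congrArg Subtype.val h) i
    exact_mod_cast this
  have hs2 := (hs.comp_injective he).mul_left ((L / (2 * Real.pi)) ^ 4)
  refine Summable.of_norm_bounded_eventually hs2 ?_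
  rw [Filter.eventually_cofinite]
  -- The comparison fails only at the zero mode, where the inverse norm is zero by convention.
  refine (Set.finite_singleton (0 : Fin d → ℤ)).subset fun k hk => ?_
  by_contra hk0
  apply hk
  have hpi := Real.pi_pos
  have hn : ‖(e k : Fin d → ℝ)‖ ≤ L / (2 * Real.pi) * Real.sqrt (freqSq L k) := by
    refine (pi_norm_le_iff_of_nonneg (by positivity)).2 fun i => ?_
    have h1 : freq L k i ^ 2 ≤ freqSq L k :=
      Finset.single_le_sum (f := fun i => freq L k i ^ 2) (fun _ _ => sq_nonneg _)
        (Finset.mem_univ i)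
    have h2 := Real.abs_le_sqrt h1
    have h3 : (e k : Fin d → ℝ) i = L / (2 * Real.pi) * freq L k i := by
      simp only [e, freq]; field_simp
    rw [h3, Real.norm_eq_abs, abs_mul, abs_of_pos (by positivity)]
    gcongr
  have hne : 0 < ‖(e k : Fin d → ℝ)‖ := by
    rw [norm_pos_iff]
    intro h
    apply hk0
    funext i
    have : ((k i : ℤ) : ℝ) = 0 := congrFun h i
    exact_mod_cast this
  have h0 := freqSq_nonneg L k
  have h4 : ‖(e k : Fin d → ℝ)‖ ^ 4 ≤ (L / (2 * Real.pi)) ^ 4 * (1 + freqSq L k) ^ 2 := by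
    calc ‖(e k : Fin d → ℝ)‖ ^ 4 ≤ (L / (2 * Real.pi) * Real.sqrt (freqSq L k)) ^ 4 := by gcongr
      _ = (L / (2 * Real.pi)) ^ 4 * (Real.sqrt (freqSq L k) ^ 2) ^ 2 := by ring
      _ ≤ _ := by
        rw [Real.sq_sqrt h0]
        gcongr
        linarith
  rw [Real.norm_of_nonneg (by positivity)]
  change _ ≤ _ * (‖(e k : Fin d → ℝ)‖⁻¹ ^ 4)
  rw [inv_pow]
  rw [← div_eq_mul_inv, inv_eq_one_div, div_le_div_iff₀ (by positivity) (by positivity)]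
  linarith

/-- The coefficient sum is controlled by an arbitrarily small multiple of the `H²` norm and
a multiple of the `L²` norm. -/
theorem exists_sq_sum_norm_le {d : ℕ} (hd : d < 4) {L : ℝ} (hL : 0 < L) {κ : ℝ} (hκ : 0 < κ) :
    ∃ C : ℝ, 0 ≤ C ∧ ∀ (S : Finset (Fin d → ℤ)) (c : (Fin d → ℤ) → ℂ),
      (∑ k ∈ S, ‖c k‖) ^ 2 ≤ κ * sob L S 2 c + C * sob L S 0 c := by
  classical
  have hs := summable_inv_sq_freqSq hd hL
  have hw : ∀ k : Fin d → ℤ, 0 < (1 + freqSq L k) ^ 2 := fun k => by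
    have := freqSq_nonneg L k; positivity
  -- Outside the finite set `F` every finite sum of the weights is below `κ / 2`. These high modes
  -- are paid for by the H² norm, and the modes in `F` by the L² norm at the price of `F.card`.
  obtain ⟨F, hF⟩ := summable_iff_vanishing_norm.1 hs (κ / 2) (by positivity)
  refine ⟨2 * F.card, by positivity, fun S c => ?_⟩
  have hsplit := Finset.sum_filter_add_sum_filter_not S (· ∈ F) fun k => ‖c k‖
  set A := ∑ k ∈ S with k ∈ F, ‖c k‖
  set B := ∑ k ∈ S with k ∉ F, ‖c k‖
  have hA : A ^ 2 ≤ F.card * sob L S 0 c := by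
    refine sq_sum_le_card_mul_sum_sq.trans ?_
    gcongr
    · intro k hk; exact (Finset.mem_filter.1 hk).2
    · simp only [sob, pow_zero, one_mul]
      exact Finset.sum_le_sum_of_subset_of_nonneg (Finset.filter_subset _ _)
        fun _ _ _ => sq_nonneg _
  have hB : B ^ 2 ≤ κ / 2 * sob L S 2 c := by
    have h1 : B ^ 2 ≤ (∑ k ∈ S with k ∉ F, ((1 + freqSq L k) ^ 2)⁻¹) *
        ∑ k ∈ S with k ∉ F, (1 + freqSq L k) ^ 2 * ‖c k‖ ^ 2 := by
      refine Finset.sum_sq_le_sum_mul_sum_of_sq_le_mul _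
        (fun k _ => (inv_pos.2 (hw k)).le) (fun k _ => mul_nonneg (hw k).le (sq_nonneg _))
        (fun k _ => ?_)
      rw [inv_mul_cancel_left₀ (hw k).ne']
    have h2 := hF (S.filter (· ∉ F)) (Finset.disjoint_left.2 fun k hk hkF =>
      (Finset.mem_filter.1 hk).2 hkF)
    rw [Real.norm_of_nonneg (Finset.sum_nonneg fun k _ => (inv_pos.2 (hw k)).le)] at h2
    refine h1.trans (mul_le_mul h2.le ?_ ?_ (by positivity))
    · exact Finset.sum_le_sum_of_subset_of_nonneg (Finset.filter_subset _ _)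
        fun k _ _ => mul_nonneg (hw k).le (sq_nonneg _)
    · exact Finset.sum_nonneg fun k _ => mul_nonneg (hw k).le (sq_nonneg _)
  rw [← hsplit]
  nlinarith [sq_nonneg (A - B)]

/-! ### Estimates of the nonlinearity and of the energy -/

section Estimates

variable {d : ℕ} {L : ℝ} {S : Finset (Fin d → ℤ)}

theorem normSq2_nonneg (L : ℝ) (u : (Fin d → ℝ) → ℂ) : 0 ≤ normSq2 L u :=
  integral_nonneg fun _ => sq_nonneg _

theorem gradNormSq_nonneg (L : ℝ) (u : (Fin d → ℝ) → ℂ) : 0 ≤ gradNormSq L u :=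
  Finset.sum_nonneg fun _ _ => normSq2_nonneg _ _

theorem normSq2_le_of_norm_le {g h : (Fin d → ℝ) → ℂ} {C : ℝ} (hh : Continuous h)
    (hgh : ∀ x, ‖g x‖ ≤ C * ‖h x‖) : normSq2 L g ≤ C ^ 2 * normSq2 L h := by
  rw [normSq2, normSq2, ← integral_const_mul]
  refine integral_mono_of_nonneg (ae_of_all _ fun _ => sq_nonneg _)
    (integrable_of_continuous (by fun_prop)) (ae_of_all _ fun x => ?_)
  simp only
  rw [← mul_pow]
  exact pow_le_pow_left₀ (norm_nonneg _) (hgh x) 2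

theorem normSq2_add_le {a b : (Fin d → ℝ) → ℂ} (ha : Continuous a) (hb : Continuous b) :
    normSq2 L (fun x => a x + b x) ≤ 2 * normSq2 L a + 2 * normSq2 L b := by
  rw [normSq2, normSq2, normSq2, ← integral_const_mul, ← integral_const_mul,
    ← integral_add (integrable_of_continuous (by fun_prop))
      (integrable_of_continuous (by fun_prop))]
  refine integral_mono_of_nonneg (ae_of_all _ fun _ => sq_nonneg _)
    (integrable_of_continuous (by fun_prop)) (ae_of_all _ fun x => ?_)
  simp only
  have := norm_add_le (a x) (b x)
  have h0 := norm_nonneg (a x + b x)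
  nlinarith [sq_nonneg (‖a x‖ - ‖b x‖)]

theorem normSq2_sum_le {g : Fin d → (Fin d → ℝ) → ℂ} (hg : ∀ i, Continuous (g i)) :
    normSq2 L (fun x => ∑ i, g i x) ≤ d * ∑ i, normSq2 L (g i) := by
  simp only [normSq2]
  rw [← integral_finsetSum _ fun i _ => (integrable_of_continuous (by fun_prop) :
      Integrable (fun x => ‖g i x‖ ^ 2) (cellMeasure d L)), ← integral_const_mul]
  refine integral_mono_of_nonneg (ae_of_all _ fun _ => sq_nonneg _)
    (integrable_of_continuous (by fun_prop)) (ae_of_all _ fun x => ?_)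
  simp only
  refine (pow_le_pow_left₀ (norm_nonneg _) (norm_sum_le _ _) 2).trans ?_
  simpa using sq_sum_le_card_mul_sum_sq (s := Finset.univ) (f := fun i => ‖g i x‖)

theorem hasDerivAt_nonlin (ε : ℝ) (z : ℂ) :
    HasDerivAt (nonlin ε) (1 / (ε : ℂ) ^ 2 * (3 * z ^ 2 - 1)) z := by
  have h := ((hasDerivAt_pow 3 z).sub (hasDerivAt_id z)).const_mul (1 / (ε : ℂ) ^ 2)
  exact h.congr_deriv (by norm_num)

theorem deriv_nonlin (ε : ℝ) :
    deriv (nonlin ε) = fun z => 1 / (ε : ℂ) ^ 2 * (3 * z ^ 2 - 1) :=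
  funext fun z => (hasDerivAt_nonlin ε z).deriv

theorem deriv_deriv_nonlin (ε : ℝ) :
    deriv (deriv (nonlin ε)) = fun z => 1 / (ε : ℂ) ^ 2 * (6 * z) := by
  rw [deriv_nonlin]
  funext z
  have := (((hasDerivAt_pow 2 z).const_mul 3).sub_const 1).const_mul (1 / (ε : ℂ) ^ 2)
  rw [this.deriv]
  push_cast
  ring

theorem hasLineDerivAt_of_differentiable {u : (Fin d → ℝ) → ℂ} (hu : Differentiable ℝ u)
    (i : Fin d) (x : Fin d → ℝ) : HasLineDerivAt ℝ u (pderiv i u x) x (Pi.single i 1) :=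
  (hu x).lineDifferentiableAt.hasLineDerivAt

theorem pderiv_nonlin {u : (Fin d → ℝ) → ℂ} (hu : Differentiable ℝ u) (ε : ℝ) (i : Fin d) :
    pderiv i (fun y => nonlin ε (u y))
      = fun x => 1 / (ε : ℂ) ^ 2 * (3 * u x ^ 2 - 1) * pderiv i u x := by
  funext x
  have h : HasLineDerivAt ℝ (fun y => nonlin ε (u y))
      (1 / (ε : ℂ) ^ 2 * (3 * u x ^ 2 - 1) * pderiv i u x) x (Pi.single i 1) := by
    have h1 : HasDerivAt (fun s : ℝ => u (x + s • Pi.single i (1 : ℝ))) (pderiv i u x) 0 :=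
      hasLineDerivAt_of_differentiable hu i x
    have h2 := (hasDerivAt_nonlin ε (u (x + (0 : ℝ) • Pi.single i (1 : ℝ)))).comp_of_eq (0 : ℝ)
      h1 rfl
    exact h2.congr_deriv (by simp)
  exact h.lineDeriv

theorem pderiv_pderiv_nonlin_trig (c : (Fin d → ℤ) → ℂ) (ε : ℝ) (i : Fin d) (x : Fin d → ℝ) :
    pderiv i (pderiv i (fun y => nonlin ε (trig L S c y))) x
      = 1 / (ε : ℂ) ^ 2 * (3 * trig L S c x ^ 2 - 1) * pderiv i (pderiv i (trig L S c)) x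
        + 6 / (ε : ℂ) ^ 2 * trig L S c x * pderiv i (trig L S c) x ^ 2 := by
  rw [pderiv_nonlin (differentiable_trig c)]
  have h1 : HasDerivAt (fun s : ℝ => trig L S c (x + s • Pi.single i (1 : ℝ)))
      (pderiv i (trig L S c) x) 0 := hasLineDerivAt_of_differentiable (differentiable_trig c) i x
  have h2 : HasDerivAt (fun s : ℝ => pderiv i (trig L S c) (x + s • Pi.single i (1 : ℝ)))
      (pderiv i (pderiv i (trig L S c)) x) 0 :=
    hasLineDerivAt_of_differentiable (by rw [pderiv_trig]; exact differentiable_trig _) i x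
  have h3 := ((((h1.pow 2).const_mul (3 : ℂ)).sub_const 1).const_mul (1 / (ε : ℂ) ^ 2)).mul h2
  have h4 : HasLineDerivAt ℝ
      (fun x => 1 / (ε : ℂ) ^ 2 * (3 * trig L S c x ^ 2 - 1) * pderiv i (trig L S c) x) _ x
      (Pi.single i 1) := h3
  rw [pderiv, h4.lineDeriv]
  simp
  ring

theorem norm_cubic_deriv_le {ε P : ℝ} {z : ℂ} (hz : ‖z‖ ≤ P) :
    ‖1 / (ε : ℂ) ^ 2 * (3 * z ^ 2 - 1)‖ ≤ (3 * P ^ 2 + 1) / ε ^ 2 := by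
  have h : ‖3 * z ^ 2 - 1‖ ≤ 3 * P ^ 2 + 1 := by
    refine (norm_sub_le _ _).trans ?_
    rw [norm_mul, norm_pow, norm_one]
    have : ‖z‖ ^ 2 ≤ P ^ 2 := pow_le_pow_left₀ (norm_nonneg _) hz 2
    have h3 : ‖(3 : ℂ)‖ = 3 := by simp
    rw [h3]
    linarith
  rw [norm_mul, norm_div, norm_pow, norm_one, Complex.norm_real, Real.norm_eq_abs, sq_abs,
    one_div, mul_comm, div_eq_mul_inv]
  exact mul_le_mul_of_nonneg_right h (by positivity)

theorem gradNormSq_nonlin_trig_le (c : (Fin d → ℤ) → ℂ) (ε : ℝ) :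
    gradNormSq L (fun y => nonlin ε (trig L S c y))
      ≤ ((3 * (∑ k ∈ S, ‖c k‖) ^ 2 + 1) / ε ^ 2) ^ 2 * gradNormSq L (trig L S c) := by
  rw [gradNormSq, gradNormSq, Finset.mul_sum]
  refine Finset.sum_le_sum fun i _ => ?_
  rw [pderiv_nonlin (differentiable_trig c)]
  refine normSq2_le_of_norm_le (by rw [pderiv_trig]; exact continuous_trig _) fun x => ?_
  rw [norm_mul]
  exact mul_le_mul_of_nonneg_right (norm_cubic_deriv_le (norm_trig_le c x)) (norm_nonneg _)

/-- One factor `∂ᵢu` is taken in the sup norm, which costs the H³ norm of `u`, and the other in L²,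
which costs only the H¹ norm. -/
theorem normSq2_sum_sq_pderiv_trig_le {A : ℝ} (hL : 0 < L) (hA : 0 ≤ A)
    (hsob : ∀ c : (Fin d → ℤ) → ℂ, (∑ k ∈ S, ‖c k‖) ^ 2 ≤ A * sob L S 2 c)
    (c : (Fin d → ℤ) → ℂ) :
    normSq2 L (fun x => ∑ i, pderiv i (trig L S c) x ^ 2)
      ≤ d * (A * sob L S 3 c * (L ^ d * sob L S 1 c)) := by
  refine (normSq2_sum_le fun i => by rw [pderiv_trig]; exact (continuous_trig _).pow 2).trans ?_
  refine mul_le_mul_of_nonneg_left ?_ (Nat.cast_nonneg d)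
  have h3 := sob_nonneg L S 3 c
  calc ∑ i, normSq2 L (fun x => pderiv i (trig L S c) x ^ 2)
      ≤ ∑ i, A * sob L S 3 c * normSq2 L (pderiv i (trig L S c)) := by
        refine Finset.sum_le_sum fun i _ => ?_
        rw [pderiv_trig]
        refine (normSq2_le_of_norm_le (continuous_trig _) (fun x => ?_)).trans
          (mul_le_mul_of_nonneg_right ((hsob fun k => Complex.I * freq L k i * c k).trans
            (mul_le_mul_of_nonneg_left (sob_freq_mul_le i 2 c) hA)) (normSq2_nonneg _ _))
        rw [norm_pow, sq]
        exact mul_le_mul_of_nonneg_right (norm_trig_le _ x) (norm_nonneg _)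
    _ = A * sob L S 3 c * gradNormSq L (trig L S c) := by rw [gradNormSq, Finset.mul_sum]
    _ ≤ _ := mul_le_mul_of_nonneg_left (gradNormSq_trig_le hL c) (by positivity)

theorem lap_nonlin_trig (c : (Fin d → ℤ) → ℂ) (ε : ℝ) :
    (lap fun y => nonlin ε (trig L S c y)) = fun x =>
      1 / (ε : ℂ) ^ 2 * (3 * trig L S c x ^ 2 - 1) * lap (trig L S c) x
        + 6 / (ε : ℂ) ^ 2 * trig L S c x * ∑ i, pderiv i (trig L S c) x ^ 2 := by
  funext x
  simp only [lap, pderiv_pderiv_nonlin_trig, Finset.sum_add_distrib, Finset.mul_sum]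

theorem continuous_lap_trig (c : (Fin d → ℤ) → ℂ) : Continuous (lap (trig L S c)) := by
  rw [lap_trig]; exact continuous_trig _

theorem continuous_pderiv_trig (i : Fin d) (c : (Fin d → ℤ) → ℂ) :
    Continuous (pderiv i (trig L S c)) := by
  rw [pderiv_trig]; exact continuous_trig _

theorem continuous_lap_nonlin_trig (c : (Fin d → ℤ) → ℂ) (ε : ℝ) :
    Continuous (lap fun y => nonlin ε (trig L S c y)) := by
  have hcu : Continuous (trig L S c) := continuous_trig c
  have hcl : Continuous (lap (trig L S c)) := continuous_lap_trig c
  have hcs : Continuous fun x => ∑ i, pderiv i (trig L S c) x ^ 2 :=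
    continuous_finsetSum _ fun i _ => (continuous_pderiv_trig i c).pow 2
  rw [lap_nonlin_trig]
  fun_prop

theorem normSq2_lap_nonlin_trig_le (c : (Fin d → ℤ) → ℂ) (ε : ℝ) :
    normSq2 L (lap fun y => nonlin ε (trig L S c y))
      ≤ 2 * (((3 * (∑ k ∈ S, ‖c k‖) ^ 2 + 1) / ε ^ 2) ^ 2 * normSq2 L (lap (trig L S c)))
        + 2 * ((6 / ε ^ 2 * ∑ k ∈ S, ‖c k‖) ^ 2
          * normSq2 L (fun x => ∑ i, pderiv i (trig L S c) x ^ 2)) := by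
  have hcu : Continuous (trig L S c) := continuous_trig c
  have hcl : Continuous (lap (trig L S c)) := continuous_lap_trig c
  have hcs : Continuous fun x => ∑ i, pderiv i (trig L S c) x ^ 2 :=
    continuous_finsetSum _ fun i _ => (continuous_pderiv_trig i c).pow 2
  rw [lap_nonlin_trig]
  refine (normSq2_add_le (by fun_prop) (by fun_prop)).trans (add_le_add ?_ ?_)
  · refine mul_le_mul_of_nonneg_left (normSq2_le_of_norm_le hcl fun x => ?_) (by norm_num)
    rw [norm_mul]
    exact mul_le_mul_of_nonneg_right (norm_cubic_deriv_le (norm_trig_le c x)) (norm_nonneg _)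
  · refine mul_le_mul_of_nonneg_left (normSq2_le_of_norm_le hcs fun x => ?_) (by norm_num)
    rw [norm_mul, norm_mul, norm_div, norm_pow, Complex.norm_real, Real.norm_eq_abs, sq_abs]
    have h6 : ‖(6 : ℂ)‖ = 6 := by simp
    rw [h6]
    gcongr
    exact norm_trig_le c x

/-- The gradient of the nonlinearity is controlled by a small multiple of the `H³` norm. -/
theorem exists_gradNormSq_nonlin_le (hd : d < 4) (hL : 0 < L) {ε M θ : ℝ} (hε : 0 < ε)
    (hM : 0 ≤ M) (hθ : 0 < θ) :
    ∃ C : ℝ, 0 ≤ C ∧ ∀ (S : Finset (Fin d → ℤ)) (c : (Fin d → ℤ) → ℂ), sob L S 1 c ≤ M →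
      gradNormSq L (fun y => nonlin ε (trig L S c y)) ≤ θ * sob L S 3 c + C := by
  set ω := L ^ d
  have hω : 0 < ω := pow_pos hL d
  -- Chosen so that the final coefficient `36 κ² M² ω / ε⁴` of the H³ term is at most `θ`; the added
  -- 1 covers `M = 0`.
  set κ := Real.sqrt (θ * ε ^ 4 / (36 * M ^ 2 * ω + 1))
  have hκ : 0 < κ := Real.sqrt_pos.2 (by positivity)
  have hκ2 : 36 * κ ^ 2 * M ^ 2 * ω / ε ^ 4 ≤ θ := by
    rw [Real.sq_sqrt (by positivity)]
    have : 36 * (θ * ε ^ 4 / (36 * M ^ 2 * ω + 1)) * M ^ 2 * ω / ε ^ 4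
        = θ * (36 * M ^ 2 * ω / (36 * M ^ 2 * ω + 1)) := by field_simp
    rw [this]
    refine mul_le_of_le_one_right hθ.le ?_
    rw [div_le_one (by positivity)]
    linarith
  obtain ⟨D, hD, hsob⟩ := exists_sq_sum_norm_le hd hL hκ
  refine ⟨(36 * D ^ 2 * M ^ 2 + 2) * (ω * M) / ε ^ 4, by positivity, fun S c hc => ?_⟩
  refine (gradNormSq_nonlin_trig_le c ε).trans ?_
  have h1 := gradNormSq_trig_le (S := S) hL c
  have h2 := hsob S c
  have hs0 := sob_nonneg L S 0 c
  have hs1 := sob_nonneg L S 1 c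
  have hs2 := sob_nonneg L S 2 c
  have hs3 := sob_nonneg L S 3 c
  have h01 : sob L S 0 c ≤ M := (sob_mono (by norm_num) c).trans hc
  have hi := sob_two_sq_le (L := L) (S := S) c
  set P := ∑ k ∈ S, ‖c k‖
  have hP4 : (P ^ 2) ^ 2 ≤ 2 * κ ^ 2 * (M * sob L S 3 c) + 2 * D ^ 2 * M ^ 2 := by
    calc (P ^ 2) ^ 2 ≤ (κ * sob L S 2 c + D * sob L S 0 c) ^ 2 :=
          pow_le_pow_left₀ (sq_nonneg P) h2 2
      _ ≤ 2 * κ ^ 2 * sob L S 2 c ^ 2 + 2 * D ^ 2 * sob L S 0 c ^ 2 := by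
          nlinarith [sq_nonneg (κ * sob L S 2 c - D * sob L S 0 c)]
      _ ≤ _ := by
          gcongr
          exact hi.trans (mul_le_mul_of_nonneg_right hc hs3)
  have h3 : (3 * P ^ 2 + 1) ^ 2 ≤ 36 * κ ^ 2 * M * sob L S 3 c + (36 * D ^ 2 * M ^ 2 + 2) := by
    nlinarith [sq_nonneg (3 * P ^ 2 - 1)]
  calc ((3 * P ^ 2 + 1) / ε ^ 2) ^ 2 * gradNormSq L (trig L S c)
      ≤ ((3 * P ^ 2 + 1) / ε ^ 2) ^ 2 * (ω * M) := by
        gcongr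
        exact h1.trans (mul_le_mul_of_nonneg_left hc hω.le)
    _ = (3 * P ^ 2 + 1) ^ 2 * (ω * M / ε ^ 4) := by field_simp
    _ ≤ (36 * κ ^ 2 * M * sob L S 3 c + (36 * D ^ 2 * M ^ 2 + 2)) * (ω * M / ε ^ 4) :=
        mul_le_mul_of_nonneg_right h3 (by positivity)
    _ = (36 * κ ^ 2 * M ^ 2 * ω / ε ^ 4) * sob L S 3 c
        + (36 * D ^ 2 * M ^ 2 + 2) * (ω * M) / ε ^ 4 := by ring
    _ ≤ _ := by gcongr

theorem exists_sq_sum_norm_le_sob_two (hd : d < 4) (hL : 0 < L) :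
    ∃ A : ℝ, 1 ≤ A ∧ ∀ (S : Finset (Fin d → ℤ)) (c : (Fin d → ℤ) → ℂ),
      (∑ k ∈ S, ‖c k‖) ^ 2 ≤ A * sob L S 2 c := by
  obtain ⟨D, hD, h⟩ := exists_sq_sum_norm_le hd hL one_pos
  refine ⟨1 + D, by linarith, fun S c => (h S c).trans ?_⟩
  have := sob_mono (L := L) (S := S) (show 0 ≤ 2 by norm_num) c
  nlinarith

/-- The form suits Gronwall: linear in the squared H² norm, with a factor that is summable in time.
In `f'(u) Δu` the fourth power of the sup norm is interpolated into H¹ times H³. In `f''(u) ∑ᵢ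
(∂ᵢu)²` the factor `u` yields the H² norm and the squared gradient yields the H³ norm. -/
theorem exists_normSq2_lap_nonlin_le (hd : d < 4) (hL : 0 < L) {ε M : ℝ} (hε : 0 < ε)
    (hM : 0 ≤ M) :
    ∃ C : ℝ, 0 ≤ C ∧ ∀ (S : Finset (Fin d → ℤ)) (c : (Fin d → ℤ) → ℂ), sob L S 1 c ≤ M →
      normSq2 L (lap fun y => nonlin ε (trig L S c y))
        ≤ C * (1 + sob L S 3 c) * sob L S 2 c := by
  set ω := L ^ d
  have hω : 0 < ω := pow_pos hL d
  obtain ⟨A, hA, hsob⟩ := exists_sq_sum_norm_le_sob_two hd hL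
  refine ⟨(36 * A ^ 2 * M + 4 + 72 * d * A ^ 2 * M) * ω / ε ^ 4, by positivity, fun S c hc => ?_⟩
  refine (normSq2_lap_nonlin_trig_le c ε).trans ?_
  have h1 := normSq2_sum_sq_pderiv_trig_le (S := S) hL (by linarith) (hsob S) c
  have h2 := normSq2_lap_trig_le (S := S) hL c
  have h3 := hsob S c
  have hs1 := sob_nonneg L S 1 c
  have hs2 := sob_nonneg L S 2 c
  have hs3 := sob_nonneg L S 3 c
  have hi := sob_two_sq_le (L := L) (S := S) c
  set P := ∑ k ∈ S, ‖c k‖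
  have hP4 : (P ^ 2) ^ 2 ≤ A ^ 2 * (M * sob L S 3 c) := by
    calc (P ^ 2) ^ 2 ≤ (A * sob L S 2 c) ^ 2 := pow_le_pow_left₀ (sq_nonneg P) h3 2
      _ = A ^ 2 * sob L S 2 c ^ 2 := by ring
      _ ≤ _ := by
          gcongr
          exact hi.trans (mul_le_mul_of_nonneg_right hc hs3)
  have h4 : (3 * P ^ 2 + 1) ^ 2 ≤ (18 * A ^ 2 * M + 2) * (1 + sob L S 3 c) := by
    have : 0 ≤ A ^ 2 * M := by positivity
    nlinarith [sq_nonneg (3 * P ^ 2 - 1)]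
  have h5 : ((3 * P ^ 2 + 1) / ε ^ 2) ^ 2 * normSq2 L (lap (trig L S c))
      ≤ (18 * A ^ 2 * M + 2) * (1 + sob L S 3 c) / ε ^ 4 * (ω * sob L S 2 c) := by
    have : ((3 * P ^ 2 + 1) / ε ^ 2) ^ 2 = (3 * P ^ 2 + 1) ^ 2 / ε ^ 4 := by field_simp
    rw [this]
    refine mul_le_mul ?_ h2 (normSq2_nonneg _ _) (by positivity)
    exact div_le_div_of_nonneg_right h4 (by positivity)
  have h6 : (6 / ε ^ 2 * P) ^ 2 * normSq2 L (fun x => ∑ i, pderiv i (trig L S c) x ^ 2)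
      ≤ 36 / ε ^ 4 * (A * sob L S 2 c) * (d * (A * (1 + sob L S 3 c) * (ω * M))) := by
    have : (6 / ε ^ 2 * P) ^ 2 = 36 / ε ^ 4 * P ^ 2 := by ring
    rw [this]
    refine mul_le_mul (mul_le_mul_of_nonneg_left h3 (by positivity)) (h1.trans ?_)
      (normSq2_nonneg _ _) (by positivity)
    gcongr
    linarith
  calc _ ≤ 2 * ((18 * A ^ 2 * M + 2) * (1 + sob L S 3 c) / ε ^ 4 * (ω * sob L S 2 c))
        + 2 * (36 / ε ^ 4 * (A * sob L S 2 c) * (d * (A * (1 + sob L S 3 c) * (ω * M)))) := by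
        linarith
    _ = _ := by ring

/-! ### The energy -/

theorem energy_nonneg (L ε : ℝ) (u : (Fin d → ℝ) → ℂ) : 0 ≤ energy L ε u :=
  integral_nonneg fun x => by
    have : 0 ≤ ∑ i, ‖pderiv i u x‖ ^ 2 := Finset.sum_nonneg fun _ _ => sq_nonneg _
    positivity

theorem energy_trig (c : (Fin d → ℤ) → ℂ) (ε : ℝ) :
    energy L ε (trig L S c) = 1 / 2 * gradNormSq L (trig L S c)
      + ∫ x, ‖trig L S c x ^ 2 - 1‖ ^ 2 / (4 * ε ^ 2) ∂(cellMeasure d L) := by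
  have hcu : Continuous (trig L S c) := continuous_trig c
  have hcp : ∀ i, Continuous (pderiv i (trig L S c)) := fun i => continuous_pderiv_trig i c
  have hs : ∀ i, Integrable (fun x => ‖pderiv i (trig L S c) x‖ ^ 2) (cellMeasure d L) :=
    fun i => integrable_of_continuous ((hcp i).norm.pow 2)
  rw [energy, integral_add, integral_const_mul, integral_finsetSum _ fun i _ => hs i]
  · rfl
  · exact (integrable_finsetSum _ fun i _ => hs i).const_mul _
  · exact integrable_of_continuous (by fun_prop)

/-- The gradient is part of the energy. The L² norm comes from the double well, since `|z|² ≤ |z² -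
1| + 1` and `|z² - 1| ≤ |z² - 1|² / (4 ε²) + ε²`. -/
theorem sob_one_le_energy (hL : 0 < L) {ε : ℝ} (hε : 0 < ε) (c : (Fin d → ℤ) → ℂ) :
    L ^ d * sob L S 1 c ≤ (3 + L ^ d * (1 + ε ^ 2)) * (energy L ε (trig L S c) + 1) := by
  have hω : 0 < L ^ d := pow_pos hL d
  have hcu : Continuous (trig L S c) := continuous_trig c
  set J := ∫ x, ‖trig L S c x ^ 2 - 1‖ ^ 2 / (4 * ε ^ 2) ∂(cellMeasure d L) with hJ
  have hE := energy_trig (L := L) (S := S) c ε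
  rw [← hJ] at hE
  have hJ0 : 0 ≤ J := integral_nonneg fun x => by positivity
  have hG := gradNormSq_nonneg L (trig L S c)
  have h1 : normSq2 L (trig L S c) ≤ J + (1 + ε ^ 2) * L ^ d := by
    have : (1 + ε ^ 2) * L ^ d = ∫ _, (1 + ε ^ 2) ∂(cellMeasure d L) := by
      rw [integral_const, cellMeasure_real_univ hL, smul_eq_mul, mul_comm]
    rw [this, hJ, ← integral_add (integrable_of_continuous (by fun_prop)) (integrable_const _),
      normSq2]
    refine integral_mono_of_nonneg (ae_of_all _ fun _ => sq_nonneg _)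
      (integrable_of_continuous (by fun_prop)) (ae_of_all _ fun x => ?_)
    simp only
    set z := trig L S c x
    have h2 : ‖z‖ ^ 2 ≤ ‖z ^ 2 - 1‖ + 1 := by
      rw [← norm_pow]
      have h := norm_add_le (z ^ 2 - 1) 1
      rwa [sub_add_cancel, norm_one] at h
    have h3 : ‖z ^ 2 - 1‖ ≤ ‖z ^ 2 - 1‖ ^ 2 / (4 * ε ^ 2) + ε ^ 2 := by
      rw [← sub_le_iff_le_add, le_div_iff₀ (by positivity)]
      nlinarith [sq_nonneg (‖z ^ 2 - 1‖ - 2 * ε ^ 2)]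
    linarith
  rw [sob_one_eq hL, hE]
  have h4 : 0 ≤ L ^ d * (1 + ε ^ 2) := by positivity
  nlinarith [mul_nonneg h4 hG, mul_nonneg h4 hJ0]

/-- Applied to the projected initial value, this bounds `γ⁰` independently of the trial space. -/
theorem exists_energy_le (hd : d < 4) (hL : 0 < L) (ε : ℝ) {M : ℝ} :
    ∃ C : ℝ, ∀ (S : Finset (Fin d → ℤ)) (c : (Fin d → ℤ) → ℂ), sob L S 2 c ≤ M →
      energy L ε (trig L S c) ≤ C := by
  obtain ⟨A, hA, hsob⟩ := exists_sq_sum_norm_le_sob_two hd hL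
  refine ⟨1 / 2 * (L ^ d * M) + L ^ d * ((A * M + 1) ^ 2 / (4 * ε ^ 2)), fun S c hc => ?_⟩
  have hω : 0 < L ^ d := pow_pos hL d
  rw [energy_trig]
  refine add_le_add (mul_le_mul_of_nonneg_left ((gradNormSq_trig_le hL c).trans
    (mul_le_mul_of_nonneg_left ((sob_mono (by norm_num) c).trans hc) hω.le)) (by norm_num)) ?_
  have : L ^ d * ((A * M + 1) ^ 2 / (4 * ε ^ 2))
      = ∫ _, ((A * M + 1) ^ 2 / (4 * ε ^ 2)) ∂(cellMeasure d L) := by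
    rw [integral_const, cellMeasure_real_univ hL, smul_eq_mul]
  rw [this]
  refine integral_mono_of_nonneg (ae_of_all _ fun _ => by positivity) (integrable_const _)
    (ae_of_all _ fun x => ?_)
  simp only
  refine div_le_div_of_nonneg_right (pow_le_pow_left₀ (norm_nonneg _) ?_ 2) (by positivity)
  refine (norm_sub_le _ _).trans ?_
  rw [norm_pow, norm_one]
  have h1 := pow_le_pow_left₀ (norm_nonneg _) (norm_trig_le (L := L) (S := S) c x) 2
  have h2 := (hsob S c).trans (mul_le_mul_of_nonneg_left hc (by linarith))
  linarith

end Estimates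

/-! ### Uniform bounds for the projection of the initial value -/

section Projection

variable {d : ℕ} {L : ℝ} {S : Finset (Fin d → ℤ)}

theorem iterPDeriv_replicate_trig (i : Fin d) (m : ℕ) (c : (Fin d → ℤ) → ℂ) :
    iterPDeriv (List.replicate m i) (trig L S c)
      = trig L S (fun k => (Complex.I * freq L k i) ^ m * c k) := by
  induction m with
  | zero => simp [iterPDeriv]
  | succ m ih =>
    have : iterPDeriv (List.replicate (m + 1) i) (trig L S c)
        = pderiv i (iterPDeriv (List.replicate m i) (trig L S c)) := rfl
    rw [this, ih, pderiv_trig]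
    congr 1
    funext k
    ring

theorem pderiv_conj (i : Fin d) (u : (Fin d → ℝ) → ℂ) :
    pderiv i (fun x => (starRingEnd ℂ) (u x)) = fun x => (starRingEnd ℂ) (pderiv i u x) :=
  funext fun _ => deriv.star

theorem iterPDeriv_conj (l : List (Fin d)) (u : (Fin d → ℝ) → ℂ) :
    iterPDeriv l (fun x => (starRingEnd ℂ) (u x))
      = fun x => (starRingEnd ℂ) (iterPDeriv l u x) := by
  induction l with
  | nil => rfl
  | cons i l ih =>
    change pderiv i (iterPDeriv l _) = fun x => (starRingEnd ℂ) (pderiv i (iterPDeriv l u) x)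
    rw [ih, pderiv_conj]

theorem iterPDeriv_append (l₁ l₂ : List (Fin d)) (u : (Fin d → ℝ) → ℂ) :
    iterPDeriv (l₁ ++ l₂) u = iterPDeriv l₁ (iterPDeriv l₂ u) :=
  List.foldr_append

theorem memLp_of_continuous {u : (Fin d → ℝ) → ℂ} (hu : Continuous u) :
    MemLp u 2 (cellMeasure d L) :=
  (memLp_two_iff_integrable_sq_norm hu.aestronglyMeasurable).2
    (integrable_of_continuous (by fun_prop))

theorem integrable_mul_conj {u v : (Fin d → ℝ) → ℂ} (hu : MemLp u 2 (cellMeasure d L))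
    (hv : Continuous v) :
    Integrable (fun x => u x * (starRingEnd ℂ) (v x)) (cellMeasure d L) :=
  hu.integrable_mul (memLp_of_continuous (Complex.continuous_conj.comp hv))

theorem norm_inner2_le {u v : (Fin d → ℝ) → ℂ} (hu : MemLp u 2 (cellMeasure d L))
    (hv : Continuous v) {s : ℝ} (hs : 0 < s) :
    2 * ‖inner2 L u v‖ ≤ s * normSq2 L u + s⁻¹ * normSq2 L v := by
  have hiu := (memLp_two_iff_integrable_sq_norm hu.1).1 hu
  have hiv : Integrable (fun x => ‖v x‖ ^ 2) (cellMeasure d L) :=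
    integrable_of_continuous (by fun_prop)
  have h1 : 2 * ‖inner2 L u v‖ ≤ 2 * ∫ x, ‖u x * (starRingEnd ℂ) (v x)‖ ∂(cellMeasure d L) :=
    mul_le_mul_of_nonneg_left (norm_integral_le_integral_norm _) (by norm_num)
  refine h1.trans ?_
  rw [normSq2, normSq2, ← integral_const_mul, ← integral_const_mul, ← integral_const_mul,
    ← integral_add (hiu.const_mul s) (hiv.const_mul s⁻¹)]
  refine integral_mono_of_nonneg (ae_of_all _ fun _ => by positivity)
    ((hiu.const_mul s).add (hiv.const_mul s⁻¹)) (ae_of_all _ fun x => ?_)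
  simp only [norm_mul, RCLike.norm_conj]
  have h2 : s * ‖u x‖ ^ 2 + s⁻¹ * ‖v x‖ ^ 2 - 2 * (‖u x‖ * ‖v x‖)
      = s⁻¹ * (s * ‖u x‖ - ‖v x‖) ^ 2 := by field_simp; ring
  have h3 : 0 ≤ s⁻¹ * (s * ‖u x‖ - ‖v x‖) ^ 2 := by positivity
  linarith

/-- The orthogonality is tested with `∂ᵢ^{2m}` of the projection `p` itself. Moving `m` derivatives
across, by Parseval for `p` and by the weak derivative for `u`, gives `‖∂ᵢ^m p‖² = (g, ∂ᵢ^m p)`, and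
Young's inequality concludes. The conjugate of `∂ᵢ^m p` is an admissible test function because it is
smooth and periodic. -/
theorem normSq2_iterPDeriv_le (hL : 0 < L) {u g : (Fin d → ℝ) → ℂ}
    (hu : MemLp u 2 (cellMeasure d L)) (hg : MemLp g 2 (cellMeasure d L)) {i : Fin d} {m : ℕ}
    (hgu : IsWeakPeriodicDeriv L (List.replicate m i) u g) (c : (Fin d → ℤ) → ℂ)
    (hort : inner2 L (trig L S c - u) (iterPDeriv (List.replicate (m + m) i) (trig L S c)) = 0) :
    normSq2 L (iterPDeriv (List.replicate m i) (trig L S c)) ≤ normSq2 L g := by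
  set q := iterPDeriv (List.replicate m i) (trig L S c) with hq
  have hqt := iterPDeriv_replicate_trig (L := L) (S := S) i m c
  rw [← hq] at hqt
  have hqc : Continuous q := by rw [hqt]; exact continuous_trig _
  have hvv : iterPDeriv (List.replicate (m + m) i) (trig L S c)
      = iterPDeriv (List.replicate m i) q := by
    rw [List.replicate_add, iterPDeriv_append]
  set v := iterPDeriv (List.replicate (m + m) i) (trig L S c) with hv
  have hvt := iterPDeriv_replicate_trig (L := L) (S := S) i (m + m) c
  rw [← hv] at hvt
  have hvc : Continuous v := by rw [hvt]; exact continuous_trig _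
  have h1 : inner2 L (trig L S c) v = (-1) ^ m * inner2 L q q := by
    rw [hvt, hqt, inner2_trig hL, inner2_trig hL, mul_left_comm, Finset.mul_sum, Finset.mul_sum,
      Finset.mul_sum]
    refine Finset.sum_congr rfl fun k _ => ?_
    simp only [map_mul, map_pow, Complex.conj_I, Complex.conj_ofReal]
    have : (-Complex.I * (freq L k i : ℂ)) ^ (m + m)
        = (-1) ^ m * ((Complex.I * freq L k i) ^ m * (-Complex.I * (freq L k i : ℂ)) ^ m) := by
      have h : (-1) ^ m * (Complex.I * (freq L k i : ℂ)) ^ m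
          = (-Complex.I * (freq L k i : ℂ)) ^ m := by
        rw [← mul_pow, neg_one_mul, neg_mul]
      rw [pow_add, ← mul_assoc, h]
    rw [this]
    ring
  have h2 : inner2 L u v = (-1) ^ m * inner2 L g q := by
    have htest : IsPeriodicTest L fun x => (starRingEnd ℂ) (q x) := by
      rw [hqt]
      exact ⟨Complex.conjCLE.contDiff.comp (contDiff_trig _), fun i x => by
        simp only [trig_periodic hL.ne']⟩
    have := hgu _ htest
    rw [iterPDeriv_conj, ← hvv, List.length_replicate] at this
    exact this
  have h3 : inner2 L (trig L S c - u) v = inner2 L (trig L S c) v - inner2 L u v := by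
    simp only [inner2, Pi.sub_apply, sub_mul]
    exact integral_sub (integrable_mul_conj (memLp_of_continuous (continuous_trig c)) hvc)
      (integrable_mul_conj hu hvc)
  rw [hort, h1, h2, ← mul_sub] at h3
  have h4 : inner2 L q q = inner2 L g q := by
    rcases mul_eq_zero.1 h3.symm with h | h
    · exact absurd h (pow_ne_zero _ (by norm_num))
    · exact sub_eq_zero.1 h
  have h5 := norm_inner2_le hg hqc one_pos
  rw [← h4, inner2_self, Complex.norm_real, Real.norm_of_nonneg (normSq2_nonneg _ _)] at h5
  linarith

theorem freqSq_pow_four_le (k : Fin d → ℤ) :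
    freqSq L k ^ 4 ≤ d ^ 3 * ∑ i, (freq L k i ^ 4) ^ 2 := by
  have h1 := sq_sum_le_card_mul_sum_sq (s := Finset.univ) (f := fun i => freq L k i ^ 2)
  have h2 := sq_sum_le_card_mul_sum_sq (s := Finset.univ) (f := fun i => (freq L k i ^ 2) ^ 2)
  simp only [Finset.card_univ, Fintype.card_fin] at h1 h2
  calc freqSq L k ^ 4 = ((∑ i, freq L k i ^ 2) ^ 2) ^ 2 := by rw [freqSq]; ring
    _ ≤ (d * ∑ i, (freq L k i ^ 2) ^ 2) ^ 2 := pow_le_pow_left₀ (sq_nonneg _) h1 2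
    _ = d ^ 2 * (∑ i, (freq L k i ^ 2) ^ 2) ^ 2 := by ring
    _ ≤ d ^ 2 * (d * ∑ i, ((freq L k i ^ 2) ^ 2) ^ 2) := by gcongr
    _ = d ^ 3 * ∑ i, (freq L k i ^ 4) ^ 2 := by
      rw [← mul_assoc, ← pow_succ]
      congr 1
      exact Finset.sum_congr rfl fun i _ => by ring

/-- Pure fourth derivatives suffice: by two uses of the power mean inequality they dominate the full
fourth-order symbol. -/
theorem sob_four_le (hL : 0 < L) (c : (Fin d → ℤ) → ℂ) :
    L ^ d * sob L S 4 c ≤ 8 * (normSq2 L (trig L S c) +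
      d ^ 3 * ∑ i, normSq2 L (iterPDeriv (List.replicate 4 i) (trig L S c))) := by
  simp only [iterPDeriv_replicate_trig, normSq2_trig hL]
  rw [← Finset.mul_sum, Finset.sum_comm, mul_left_comm, ← mul_add, mul_left_comm, Finset.mul_sum,
    ← Finset.sum_add_distrib, Finset.mul_sum]
  refine mul_le_mul_of_nonneg_left (Finset.sum_le_sum fun k _ => ?_) (by positivity)
  have h0 := freqSq_nonneg L k
  have h1 : ∑ i, ‖(Complex.I * freq L k i) ^ 4 * c k‖ ^ 2
      = (∑ i, (freq L k i ^ 4) ^ 2) * ‖c k‖ ^ 2 := by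
    rw [Finset.sum_mul]
    refine Finset.sum_congr rfl fun i _ => ?_
    rw [norm_mul, norm_pow, norm_mul, Complex.norm_I, one_mul, Complex.norm_real, mul_pow,
      Real.norm_eq_abs, ← abs_pow, sq_abs]
  have h2 : (1 + freqSq L k) ^ 4 ≤ 8 * (1 + freqSq L k ^ 4) := by
    have h3 : (1 + freqSq L k) ^ 2 ≤ 2 * (1 + freqSq L k ^ 2) := by
      nlinarith [sq_nonneg (freqSq L k - 1)]
    have h4 : ((1 + freqSq L k) ^ 2) ^ 2 ≤ (2 * (1 + freqSq L k ^ 2)) ^ 2 :=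
      pow_le_pow_left₀ (sq_nonneg _) h3 2
    nlinarith [sq_nonneg (freqSq L k ^ 2 - 1)]
  have h5 := freqSq_pow_four_le (L := L) k
  rw [h1]
  have h6 : (1 + freqSq L k) ^ 4 ≤ 8 * (1 + d ^ 3 * ∑ i, (freq L k i ^ 4) ^ 2) := by linarith
  calc _ ≤ 8 * (1 + d ^ 3 * ∑ i, (freq L k i ^ 4) ^ 2) * ‖c k‖ ^ 2 :=
        mul_le_mul_of_nonneg_right h6 (sq_nonneg _)
    _ = _ := by ring

/-- The `H⁴` norm of the projection is bounded uniformly in the trial space, as soon as the trial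
space is closed under partial derivatives. -/
theorem exists_sob_four_le (hd : 0 < d) (hL : 0 < L) {u : (Fin d → ℝ) → ℂ} (hu : MemHper 4 L u) :
    ∃ C : ℝ, 0 ≤ C ∧ ∀ (V : Set ((Fin d → ℝ) → ℂ)) (S : Finset (Fin d → ℤ))
      (c : (Fin d → ℤ) → ℂ), (∀ i, ∀ v ∈ V, pderiv i v ∈ V) → IsL2Proj L V u (trig L S c) →
      sob L S 4 c ≤ C := by
  obtain ⟨hu2, hder⟩ := hu
  obtain ⟨g₀, hg₀, hw₀⟩ := hder [] (by simp)
  choose g hg hw using fun i : Fin d => hder (List.replicate 4 i) (by simp)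
  have hω : 0 < L ^ d := pow_pos hL d
  refine ⟨8 * (normSq2 L g₀ + d ^ 3 * ∑ i, normSq2 L (g i)) / L ^ d, ?_, ?_⟩
  · have := normSq2_nonneg L g₀
    have : 0 ≤ ∑ i, normSq2 L (g i) := Finset.sum_nonneg fun i _ => normSq2_nonneg _ _
    positivity
  intro V S c hV ⟨hp, hort⟩
  have hmem : ∀ (i : Fin d) (m : ℕ), iterPDeriv (List.replicate m i) (trig L S c) ∈ V := by
    intro i m
    induction m with
    | zero => exact hp
    | succ m ih => exact hV i _ ih
  rw [le_div_iff₀' hω]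
  refine (sob_four_le hL c).trans ?_
  have h4 : ∀ i, normSq2 L (iterPDeriv (List.replicate 4 i) (trig L S c)) ≤ normSq2 L (g i) :=
    fun i => normSq2_iterPDeriv_le hL hu2 (hg i) (hw i) c (hort _ (hmem i _))
  -- The case `m = 0`: the direction is irrelevant, but one has to exist, hence `0 < d`.
  have h0 : normSq2 L (trig L S c) ≤ normSq2 L g₀ :=
    normSq2_iterPDeriv_le hL hu2 hg₀ (i := ⟨0, hd⟩) (m := 0) hw₀ c (hort _ hp)
  gcongr with i
  exact h4 i

end Projection

/-! ### The BDF2 kernel -/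

theorem four_le_rMax : 4 ≤ rMax := by
  have h := rMax_spec
  set a := rMax
  by_contra hlt
  push Not at hlt
  nlinarith [sq_nonneg (2 * a + 1), mul_nonneg (sq_nonneg a) (sub_nonneg.2 hlt.le),
    sq_nonneg (3 * a + 1), sq_nonneg a]

/-- Square root of the defining equation. It says that `r^(3/2) / (1 + r)` and `(2 (1 + 2 r) -
r^(3/2)) / (1 + r)` coincide at `r = r_max`. -/
theorem sqrt_rMax_pow_three : Real.sqrt rMax ^ 3 = 2 * rMax + 1 := by
  have h4 := four_le_rMax
  have h : (Real.sqrt rMax ^ 3) ^ 2 = (2 * rMax + 1) ^ 2 := by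
    rw [← rMax_spec, ← pow_mul, mul_comm 3 2, pow_mul, Real.sq_sqrt (by linarith)]
  exact (sq_eq_sq₀ (by positivity) (by linarith)).1 h

/-- The constants in the positivity of the BDF2 kernel with step ratios below `r_max`. -/
theorem exists_bdf_const {ρ : ℝ} (hρ0 : 0 ≤ ρ) (hρ : ρ < rMax) :
    ∃ g c : ℝ, 0 ≤ g ∧ 0 < c ∧ ∀ r, 0 ≤ r → r ≤ ρ →
      r * Real.sqrt r / (1 + r) ≤ g ∧
        g + 2 * c ≤ (2 * (1 + 2 * r) - r * Real.sqrt r) / (1 + r) := by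
  have h4 := four_le_rMax
  set σ := Real.sqrt rMax with hσ
  have hσ2 : σ ^ 2 = rMax := Real.sq_sqrt (by linarith)
  have hσ3 : σ ^ 3 = 2 * rMax + 1 := sqrt_rMax_pow_three
  have hσ2' : 2 ≤ σ := Real.le_sqrt_of_sq_le (by linarith)
  rw [← hσ2] at hσ3
  -- `G` is the common value at `r_max` of the two kernel functions, and `g` below is the value at
  -- `ρ` of the increasing function `r^(3/2) / (1 + r)`. The gap `G - g > 0` supplies `2 c`.
  set G := σ ^ 3 / (1 + σ ^ 2) with hG
  have hGm : G * (1 + σ ^ 2) = σ ^ 3 := by rw [hG]; field_simp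
  set q := Real.sqrt ρ with hq
  have hq0 : 0 ≤ q := Real.sqrt_nonneg _
  have hq2 : q ^ 2 = ρ := Real.sq_sqrt hρ0
  have hqσ : q < σ := Real.sqrt_lt_sqrt hρ0 hρ
  set g := q ^ 3 / (1 + q ^ 2) with hg
  have hgG : g < G := by
    rw [hg, hG, div_lt_div_iff₀ (by positivity) (by positivity)]
    have h1 : q ^ 3 < σ ^ 3 := pow_lt_pow_left₀ hqσ hq0 (by norm_num)
    have h2 : 0 ≤ (q * σ) ^ 2 * (σ - q) := mul_nonneg (sq_nonneg _) (by linarith)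
    nlinarith
  refine ⟨g, (G - g) / 2, by positivity, by linarith, fun r hr0 hr => ?_⟩
  set s := Real.sqrt r
  have hs0 : 0 ≤ s := Real.sqrt_nonneg _
  have hs2 : s ^ 2 = r := Real.sq_sqrt hr0
  have hsq : s ≤ q := Real.sqrt_le_sqrt hr
  rw [← hs2]
  constructor
  · rw [hg, div_le_div_iff₀ (by positivity) (by positivity)]
    have h1 : s ^ 3 ≤ q ^ 3 := pow_le_pow_left₀ hs0 hsq 3
    have h2 : 0 ≤ (s * q) ^ 2 * (q - s) := mul_nonneg (sq_nonneg _) (by linarith)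
    nlinarith
  · have hsσ : s ≤ σ := hsq.trans hqσ.le
    rw [le_div_iff₀ (by positivity)]
    have hG2 : G ≤ 2 := by
      rw [hG, div_le_iff₀ (by positivity)]; linarith
    have hG9 : 9 / 5 ≤ G := by
      rw [hG, le_div_iff₀ (by positivity)]; nlinarith
    -- The difference of the two sides vanishes at `s = σ`. For `s ≤ 2` the bound `G ≤ 2` is enough;
    -- for `s ≥ 2` the factor `σ - s` is split off, and the cofactor is nonnegative because `G ≥ 9 /
    -- 5` and `σ + s ≥ 4`.
    have key : G * (1 + s ^ 2) ≤ 2 + 4 * s ^ 2 - s ^ 3 := by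
      rcases le_total s 2 with h2 | h2
      · have : 0 ≤ s ^ 2 * (2 - s) := mul_nonneg (sq_nonneg _) (by linarith)
        nlinarith [sq_nonneg s]
      · have h5 : 0 ≤ (σ ^ 2 + σ * s + s ^ 2) - (4 - G) * (σ + s) := by
          nlinarith [sq_nonneg (σ - s)]
        have h6 := mul_nonneg (sub_nonneg.2 hsσ) h5
        nlinarith
    linarith

/-! ### Discrete inequalities -/

section Sums

variable {n : ℕ} {τ X : ℕ → ℝ} {ρ : ℝ}

/-- Shifting the index of `X` against the weights costs a factor `ρ`, by the bound on the step
ratios, and leaves the initial term. -/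
theorem sum_step_mul_le (hX : ∀ k, 0 ≤ X k) (hτ : ∀ k, 0 ≤ τ k)
    (hρ : 0 ≤ ρ) (hr : ∀ k, k + 1 < n → τ (k + 1) ≤ ρ * τ k) :
    ∑ k ∈ Finset.range n, τ k * X k
      ≤ τ 0 * X 0 + ρ * ∑ k ∈ Finset.range n, τ k * X (k + 1) := by
  cases n with
  | zero => simpa using mul_nonneg (hτ 0) (hX 0)
  | succ m =>
    have h1 : ∑ k ∈ Finset.range m, τ (k + 1) * X (k + 1)
        ≤ ρ * ∑ k ∈ Finset.range m, τ k * X (k + 1) := by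
      rw [Finset.mul_sum]
      refine Finset.sum_le_sum fun k hk => ?_
      rw [← mul_assoc]
      exact mul_le_mul_of_nonneg_right (hr k (by simpa using hk)) (hX _)
    have h2 : 0 ≤ ρ * (τ m * X (m + 1)) := mul_nonneg hρ (mul_nonneg (hτ _) (hX _))
    rw [Finset.sum_range_succ', Finset.sum_range_succ _ m, mul_add]
    linarith

theorem sum_step_mul_delay_le (hX : ∀ k, 0 ≤ X k) (hτ : ∀ k, 0 ≤ τ k)
    (hρ : 0 ≤ ρ) (hr : ∀ k, k + 1 < n → τ (k + 1) ≤ ρ * τ k) :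
    ∑ k ∈ Finset.range n, τ k * (X k + X (k - 1))
      ≤ (2 + ρ) * (τ 0 * X 0) + (ρ + ρ ^ 2) * ∑ k ∈ Finset.range n, τ k * X (k + 1) := by
  have h1 := sum_step_mul_le hX hτ hρ hr
  -- At `k = 0` the delayed index is again 0, so the shift produces one more copy of the initial
  -- term.
  have h2 : ∑ k ∈ Finset.range n, τ k * X (k - 1)
      ≤ τ 0 * X 0 + ρ * ∑ k ∈ Finset.range n, τ k * X k := by
    cases n with
    | zero => simpa using mul_nonneg (hτ 0) (hX 0)
    | succ m =>
      rw [Finset.sum_range_succ', Finset.sum_range_succ _ m, mul_add, Finset.mul_sum]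
      have h3 : ∑ k ∈ Finset.range m, τ (k + 1) * X (k + 1 - 1)
          ≤ ∑ k ∈ Finset.range m, ρ * (τ k * X k) := by
        refine Finset.sum_le_sum fun k hk => ?_
        rw [← mul_assoc]
        exact mul_le_mul_of_nonneg_right (hr k (by simpa using hk)) (hX _)
      have h4 : 0 ≤ ρ * (τ m * X m) := mul_nonneg hρ (mul_nonneg (hτ _) (hX _))
      simp only [zero_le, Nat.sub_eq_zero_of_le] at *
      linarith
  simp only [mul_add, Finset.sum_add_distrib]
  nlinarith [mul_le_mul_of_nonneg_left h1 hρ]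

/-- A delayed inequality with a small coefficient, summed over the time steps. -/
theorem sum_step_le_of_delay {P : ℕ → ℝ} {C θ : ℝ} (hX : ∀ k, 0 ≤ X k) (hτ : ∀ k, 0 ≤ τ k)
    (hρ : 0 ≤ ρ) (hr : ∀ k, k + 1 < n → τ (k + 1) ≤ ρ * τ k) (hθ : 0 ≤ θ)
    (hθρ : θ * (ρ + ρ ^ 2) ≤ 1 / 2)
    (h : ∀ k < n, X (k + 1) ≤ P k + C + θ * (X k + X (k - 1))) :
    ∑ k ∈ Finset.range n, τ k * X (k + 1)
      ≤ 2 * (∑ k ∈ Finset.range n, τ k * P k + C * ∑ k ∈ Finset.range n, τ k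
        + θ * (2 + ρ) * (τ 0 * X 0)) := by
  have h1 := sum_step_mul_delay_le hX hτ hρ hr
  have h2 : ∑ k ∈ Finset.range n, τ k * X (k + 1) ≤
      ∑ k ∈ Finset.range n, τ k * P k + C * ∑ k ∈ Finset.range n, τ k
        + θ * ∑ k ∈ Finset.range n, τ k * (X k + X (k - 1)) := by
    rw [Finset.mul_sum, Finset.mul_sum, ← Finset.sum_add_distrib, ← Finset.sum_add_distrib]
    refine Finset.sum_le_sum fun k hk => ?_
    have := mul_le_mul_of_nonneg_left (h k (Finset.mem_range.1 hk)) (hτ k)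
    linarith
  have h3 : 0 ≤ ∑ k ∈ Finset.range n, τ k * X (k + 1) :=
    Finset.sum_nonneg fun k _ => mul_nonneg (hτ _) (hX _)
  nlinarith [mul_le_mul_of_nonneg_left h1 hθ, mul_le_mul_of_nonneg_right hθρ h3]

/-- Telescoping from `μ ≤ exp μ - 1`. -/
theorem sum_mul_exp_le {μ : ℕ → ℝ} (m : ℕ) :
    ∑ k ∈ Finset.range m, μ k * Real.exp (∑ j ∈ Finset.range k, μ j)
      ≤ Real.exp (∑ j ∈ Finset.range m, μ j) - 1 := by
  induction m with
  | zero => simp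
  | succ m ih =>
    rw [Finset.sum_range_succ, Finset.sum_range_succ, Real.exp_add]
    have h1 := Real.add_one_le_exp (μ m)
    have h2 := Real.exp_pos (∑ j ∈ Finset.range m, μ j)
    nlinarith

/-- Discrete Gronwall inequality with a delay. -/
theorem le_mul_exp_of_delay {a μ : ℕ → ℝ} {A : ℝ} (hA : 0 ≤ A) (hμ : ∀ k, 0 ≤ μ k)
    (h : ∀ m ≤ n, a m ≤ A + ∑ k ∈ Finset.range m, μ k * (a k + a (k - 1))) (m : ℕ) (hm : m ≤ n) :
    a m ≤ A * Real.exp (∑ k ∈ Finset.range m, 2 * μ k) := by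
  induction m using Nat.strong_induction_on with
  | _ m ih =>
    have hmono : ∀ k, Real.exp (∑ j ∈ Finset.range (k - 1), 2 * μ j)
        ≤ Real.exp (∑ j ∈ Finset.range k, 2 * μ j) := fun k =>
      Real.exp_le_exp.2 (Finset.sum_le_sum_of_subset_of_nonneg
        (Finset.range_mono (Nat.sub_le k 1)) fun j _ _ => by linarith [hμ j])
    have h1 : ∑ k ∈ Finset.range m, μ k * (a k + a (k - 1))
        ≤ A * ∑ k ∈ Finset.range m, 2 * μ k * Real.exp (∑ j ∈ Finset.range k, 2 * μ j) := by
      rw [Finset.mul_sum]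
      refine Finset.sum_le_sum fun k hk => ?_
      have hk' := Finset.mem_range.1 hk
      have h2 := ih k hk' (by omega)
      have h3 := (ih (k - 1) (by omega) (by omega)).trans (mul_le_mul_of_nonneg_left (hmono k) hA)
      have := mul_le_mul_of_nonneg_left (add_le_add h2 h3) (hμ k)
      linarith
    have h4 := mul_le_mul_of_nonneg_left (sum_mul_exp_le (μ := fun k => 2 * μ k) m) hA
    have h5 := h m hm
    linarith

end Sums

/-! ### The trial spaces -/

section TrialSpace

variable {d : ℕ} {L : ℝ}

/-- A common finite frequency set serves all functions. It may be larger than the set of modes of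
the space, since no estimate depends on its size. -/
theorem exists_trig_of_mem_fourierSpace (d N : ℕ) (L : ℝ) :
    ∃ S : Finset (Fin d → ℤ), ∀ u ∈ fourierSpace d N L, ∃ c, u = trig L S c := by
  classical
  refine ⟨Fintype.piFinset fun _ => Finset.Icc (-(N : ℤ)) N, fun u hu => ?_⟩
  induction hu using Submodule.span_induction with
  | mem u hu =>
    obtain ⟨k, hk, rfl⟩ := hu
    refine ⟨Pi.single k 1, ?_⟩
    have hmem : k ∈ Fintype.piFinset fun _ : Fin d => Finset.Icc (-(N : ℤ)) N := by
      rw [Fintype.mem_piFinset]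
      intro j
      have hN : (0 : ℝ) ≤ N := Nat.cast_nonneg N
      rw [Finset.mem_Icc]
      constructor
      · have : (-(N : ℝ)) ≤ k j := by linarith [(hk j).1]
        exact_mod_cast this
      · have : (k j : ℝ) ≤ N := by linarith [(hk j).2]
        exact_mod_cast this
    funext x
    simp [trig, Pi.single_apply, hmem]
  | zero => exact ⟨0, by funext x; simp [trig]⟩
  | add u v _ _ hu hv =>
    obtain ⟨a, rfl⟩ := hu
    obtain ⟨b, rfl⟩ := hv
    exact ⟨a + b, (trig_add a b).symm⟩
  | smul z u _ hu =>
    obtain ⟨a, rfl⟩ := hu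
    exact ⟨fun k => z * a k, by funext x; simp [trig, Finset.mul_sum, mul_assoc]⟩

theorem pderiv_fourierMode (i : Fin d) (k : Fin d → ℤ) :
    pderiv i (fourierMode L k) = (Complex.I * freq L k i) • fourierMode L k :=
  funext fun x => (hasLineDerivAt_fourierMode i k x).lineDeriv

theorem pderiv_mem_fourierSpace {N : ℕ} (i : Fin d) {u : (Fin d → ℝ) → ℂ}
    (hu : u ∈ fourierSpace d N L) : pderiv i u ∈ fourierSpace d N L := by
  suffices h : Differentiable ℝ u ∧ pderiv i u ∈ fourierSpace d N L from h.2
  induction hu using Submodule.span_induction with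
  | mem u hu =>
    obtain ⟨k, hk, rfl⟩ := hu
    rw [pderiv_fourierMode]
    exact ⟨(contDiff_fourierMode k).differentiable (by simp),
      Submodule.smul_mem _ _ (Submodule.subset_span ⟨k, hk, rfl⟩)⟩
  | zero =>
    have : pderiv i (0 : (Fin d → ℝ) → ℂ) = 0 := by
      funext x; simp [pderiv, lineDeriv]
    rw [this]
    exact ⟨differentiable_const 0, Submodule.zero_mem _⟩
  | add u v _ _ hu hv =>
    have : pderiv i (u + v) = pderiv i u + pderiv i v := funext fun x =>
      HasDerivAt.deriv ((hasLineDerivAt_of_differentiable hu.1 i x).add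
        (hasLineDerivAt_of_differentiable hv.1 i x))
    rw [this]
    exact ⟨hu.1.add hv.1, Submodule.add_mem _ hu.2 hv.2⟩
  | smul z u _ hu =>
    have : pderiv i (z • u) = z • pderiv i u := funext fun x =>
      HasDerivAt.deriv ((hasLineDerivAt_of_differentiable hu.1 i x).const_smul z)
    rw [this]
    exact ⟨hu.1.const_smul z, Submodule.smul_mem _ _ hu.2⟩

theorem pderiv_mem_realFourierSpace {N : ℕ} (i : Fin d) {u : (Fin d → ℝ) → ℂ}
    (hu : u ∈ realFourierSpace d N L) : pderiv i u ∈ realFourierSpace d N L := by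
  refine ⟨pderiv_mem_fourierSpace i hu.1, fun x => ?_⟩
  have h : (fun x => (starRingEnd ℂ) (u x)) = u := funext fun x =>
    Complex.conj_eq_iff_im.2 (hu.2 x)
  have h2 := congrFun (pderiv_conj i u) x
  rw [h] at h2
  exact Complex.conj_eq_iff_im.1 h2.symm

theorem sub_mem_realFourierSpace {N : ℕ} {u v : (Fin d → ℝ) → ℂ}
    (hu : u ∈ realFourierSpace d N L) (hv : v ∈ realFourierSpace d N L) :
    u - v ∈ realFourierSpace d N L :=
  ⟨Submodule.sub_mem _ hu.1 hv.1, fun x => by simp [hu.2 x, hv.2 x]⟩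

end TrialSpace

/-! ### One step of the scheme -/

section Scheme

variable {d : ℕ} {L ε : ℝ} {S : Finset (Fin d → ℤ)} {t : ℕ → ℝ}

/-- The coefficients of the extrapolated value `Bφⁿ⁻¹`. -/
def extrapCoef (t : ℕ → ℝ) (c : ℕ → (Fin d → ℤ) → ℂ) (n : ℕ) : (Fin d → ℤ) → ℂ :=
  (1 + ratio t n) • c (n - 1) - ratio t n • c (n - 2)

theorem extrap_eq_trig {K : ℕ} {φ : ℕ → (Fin d → ℝ) → ℂ} {c : ℕ → (Fin d → ℤ) → ℂ}
    (hc : ∀ m ≤ K, φ m = trig L S (c m)) {n : ℕ} (hn : 1 ≤ n) (hnK : n ≤ K) :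
    extrap t φ n = trig L S (extrapCoef t c n) := by
  rw [extrapCoef, trig_sub, trig_smul, trig_smul, ← hc _ (by omega), ← hc _ (by omega), extrap]
  split_ifs with h
  · obtain rfl : n = 1 := by omega
    simp [ratio]
  · rfl

theorem sob_extrapCoef_le {n : ℕ} (h0 : 0 ≤ ratio t n) (h1 : ratio t n ≤ rMax) (m : ℕ)
    (c : ℕ → (Fin d → ℤ) → ℂ) :
    sob L S m (extrapCoef t c n)
      ≤ 2 * (1 + rMax) ^ 2 * (sob L S m (c (n - 1)) + sob L S m (c (n - 2))) := by
  refine (sob_sub_le m _ _).trans ?_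
  rw [sob_smul, sob_smul]
  have ha := sob_nonneg L S m (c (n - 1))
  have hb := sob_nonneg L S m (c (n - 2))
  have h2 : (1 + ratio t n) ^ 2 ≤ (1 + rMax) ^ 2 := by gcongr
  have h3 : ratio t n ^ 2 ≤ (1 + rMax) ^ 2 := by gcongr; linarith
  nlinarith [mul_le_mul_of_nonneg_right h2 ha, mul_le_mul_of_nonneg_right h3 hb]

theorem bdf2_eq (t : ℕ → ℝ) (u : ℕ → (Fin d → ℝ) → ℂ) {n : ℕ} (hn : 1 ≤ n) :
    bdf2 t u n = ((1 + 2 * ratio t n) / (step t n * (1 + ratio t n))) • (u n - u (n - 1))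
      + (-(ratio t n ^ 2 / (step t n * (1 + ratio t n)))) • (u (n - 1) - u (n - 1 - 1)) := by
  rw [bdf2]
  obtain ⟨m, rfl⟩ : ∃ m, n = m + 1 := ⟨n - 1, by omega⟩
  rw [Finset.sum_Icc_succ_top (by omega)]
  cases m with
  | zero => simp [bdfKernel]
  | succ m =>
    rw [Finset.sum_Icc_succ_top (by omega)]
    have hz : ∑ k ∈ Finset.Icc 1 m, bdfKernel t (m + 1 + 1) (m + 1 + 1 - k) • (u k - u (k - 1))
        = 0 := by
      refine Finset.sum_eq_zero fun k hk => ?_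
      have hk' := Finset.mem_Icc.1 hk
      have h1 : m + 1 + 1 - k ≠ 0 := by omega
      have h2 : m + 1 + 1 - k ≠ 1 := by omega
      simp [bdfKernel, h1, h2]
    rw [hz, zero_add, add_comm]
    simp [bdfKernel]

theorem inner2_smul_add_smul (hL : 0 < L) (r s : ℝ) (a b w : (Fin d → ℤ) → ℂ) :
    (inner2 L (r • trig L S a + s • trig L S b) (trig L S w)).re
      = r * (inner2 L (trig L S a) (trig L S w)).re
        + s * (inner2 L (trig L S b) (trig L S w)).re := by
  rw [← trig_smul, ← trig_smul, ← trig_add, inner2_trig hL, inner2_trig hL, inner2_trig hL,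
    ← Complex.re_ofReal_mul, ← Complex.re_ofReal_mul, ← Complex.add_re]
  congr 1
  rw [mul_left_comm (r : ℂ), mul_left_comm (s : ℂ), ← mul_add, Finset.mul_sum _ _ (r : ℂ), Finset.mul_sum _ _ (s : ℂ),
    ← Finset.sum_add_distrib]
  congr 1
  refine Finset.sum_congr rfl fun k _ => ?_
  simp only [Pi.add_apply, Pi.smul_apply, Complex.real_smul]
  ring

/-- Mode by mode, `|a|² - |b|² ≤ 2 Re (a (a - b)̄)`, the difference being `|a - b|²`. -/
theorem normSq2_lap_sub_le (hL : 0 < L) (a b : (Fin d → ℤ) → ℂ) :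
    normSq2 L (lap (trig L S a)) - normSq2 L (lap (trig L S b))
      ≤ 2 * (inner2 L (lap (lap (trig L S a))) (trig L S (a - b))).re := by
  rw [normSq2_lap_trig hL, normSq2_lap_trig hL, lap_trig, lap_trig, inner2_trig hL,
    ← Complex.ofReal_pow, Complex.re_ofReal_mul, Complex.re_sum, ← mul_sub, mul_left_comm,
    ← Finset.sum_sub_distrib, Finset.mul_sum _ _ (2 : ℝ)]
  refine mul_le_mul_of_nonneg_left (Finset.sum_le_sum fun k _ => ?_) (pow_pos hL d).le
  have h1 : -((freqSq L k : ℝ) : ℂ) * (-((freqSq L k : ℝ) : ℂ) * a k)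
      * (starRingEnd ℂ) ((a - b) k)
      = ((freqSq L k ^ 2 : ℝ) : ℂ) * (a k * (starRingEnd ℂ) (a k - b k)) := by
    rw [Pi.sub_apply]; push_cast; ring
  rw [h1, Complex.re_ofReal_mul, ← mul_sub, mul_left_comm]
  refine mul_le_mul_of_nonneg_left ?_ (sq_nonneg _)
  rw [← Complex.normSq_eq_norm_sq, ← Complex.normSq_eq_norm_sq, Complex.normSq_apply,
    Complex.normSq_apply]
  simp only [Complex.mul_re, Complex.conj_re, Complex.conj_im, Complex.sub_re, Complex.sub_im]
  nlinarith [sq_nonneg ((a k).re - (b k).re), sq_nonneg ((a k).im - (b k).im)]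

/-- The energy estimate for one step of the variable step BDF2 scheme, tested with the backward
difference. -/
theorem bdf2_step_estimate (hL : 0 < L) {g κ : ℝ} (hκ : 0 < κ) {n : ℕ} (hn : 1 ≤ n)
    (hτ : 0 < step t n) (hτ' : 2 ≤ n → 0 < step t (n - 1)) (hr : 0 ≤ ratio t n)
    (hg1 : ratio t n * Real.sqrt (ratio t n) / (1 + ratio t n) ≤ g)
    (hg2 : g + 2 * κ
      ≤ (2 * (1 + 2 * ratio t n) - ratio t n * Real.sqrt (ratio t n)) / (1 + ratio t n))
    (a : ℕ → (Fin d → ℤ) → ℂ) {F : (Fin d → ℝ) → ℂ} (hF : Continuous F)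
    (hevo : inner2 L (bdf2 t (fun m => trig L S (a m)) n) (trig L S (a n - a (n - 1)))
      + inner2 L (lap (lap (trig L S (a n)))) (trig L S (a n - a (n - 1)))
      - inner2 L F (trig L S (a n - a (n - 1))) = 0) :
    (g + κ) * (normSq2 L (trig L S (a n - a (n - 1))) / step t n)
        + normSq2 L (lap (trig L S (a n)))
      ≤ g * (normSq2 L (trig L S (a (n - 1) - a (n - 1 - 1))) / step t (n - 1))
        + normSq2 L (lap (trig L S (a (n - 1)))) + step t n / κ * normSq2 L F := by
  set w := a n - a (n - 1) with hw
  set w' := a (n - 1) - a (n - 1 - 1) with hw'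
  set r := ratio t n with hr_def
  set τ := step t n
  rw [bdf2_eq t _ hn, ← trig_sub, ← trig_sub, ← hw, ← hw', ← hr_def] at hevo
  have h1 := congrArg Complex.re hevo
  rw [Complex.sub_re, Complex.add_re, inner2_smul_add_smul hL, inner2_self, Complex.ofReal_re,
    Complex.zero_re] at h1
  have h2 := normSq2_lap_sub_le (S := S) hL (a n) (a (n - 1))
  rw [← hw] at h2
  -- The weight `τ / κ` makes the forcing cost exactly one of the two spare `κ` in `g + 2 κ`.
  have h3 := norm_inner2_le (memLp_of_continuous (L := L) hF)
    (continuous_trig (L := L) (S := S) w) (div_pos hτ hκ)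
  have h4 := Complex.re_le_norm (inner2 L F (trig L S w))
  -- Young's inequality with weight `√r`: since `τₙ = r τₙ₋₁`, the two differences then receive the
  -- same coefficient `r^(3/2) / (1 + r)`, each over its own step. For `r = 0`, in particular in the
  -- first step, both sides vanish.
  have h5 : 2 * (r ^ 2 / (τ * (1 + r))) * (inner2 L (trig L S w') (trig L S w)).re
      ≤ r * Real.sqrt r / (1 + r) * (normSq2 L (trig L S w) / τ)
        + r * Real.sqrt r / (1 + r) * (normSq2 L (trig L S w') / step t (n - 1)) := by
    rcases hr.eq_or_lt with h0 | h0
    · rw [← h0]; simp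
    · have hn2 : 2 ≤ n := by
        by_contra hlt
        obtain rfl : n = 1 := by omega
        simp [hr_def, ratio] at h0
      have hτ1 := hτ' hn2
      have hττ : τ = r * step t (n - 1) := by
        rw [hr_def, ratio, if_neg (by omega)]
        field_simp
        rfl
      have hs := Real.sqrt_pos.2 h0
      have hs2 : Real.sqrt r * Real.sqrt r = r := Real.mul_self_sqrt hr
      have h6 := norm_inner2_le (memLp_of_continuous (L := L) (continuous_trig (L := L) (S := S) w'))
        (continuous_trig (L := L) (S := S) w) hs
      have h7 := Complex.re_le_norm (inner2 L (trig L S w') (trig L S w))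
      have h8 : 0 ≤ r ^ 2 / (τ * (1 + r)) := by positivity
      have h9 : (Real.sqrt r)⁻¹ = Real.sqrt r / r := by
        rw [eq_div_iff h0.ne', inv_mul_eq_iff_eq_mul₀ hs.ne', hs2]
      calc 2 * (r ^ 2 / (τ * (1 + r))) * (inner2 L (trig L S w') (trig L S w)).re
          ≤ r ^ 2 / (τ * (1 + r)) * (Real.sqrt r * normSq2 L (trig L S w')
            + (Real.sqrt r)⁻¹ * normSq2 L (trig L S w)) := by
            nlinarith
        _ = _ := by
            rw [h9, hττ]
            field_simp
            ring
  set A := normSq2 L (trig L S w)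
  set B := normSq2 L (trig L S w')
  have hA : 0 ≤ A / τ := div_nonneg (normSq2_nonneg _ _) hτ.le
  have hB : 0 ≤ B / step t (n - 1) := by
    rcases Nat.lt_or_ge n 2 with h | h
    · obtain rfl : n = 1 := by omega
      simp [step]
    · exact div_nonneg (normSq2_nonneg _ _) (hτ' h).le
  have h10 : (τ / κ)⁻¹ * A = κ * (A / τ) := by field_simp
  rw [h10] at h3
  have h11 := mul_le_mul_of_nonneg_right hg1 hB
  have h12 := mul_le_mul_of_nonneg_right hg2 hA
  have h13 : (2 * (1 + 2 * r) - r * Real.sqrt r) / (1 + r) * (A / τ)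
      = 2 * ((1 + 2 * r) / (τ * (1 + r)) * A) - r * Real.sqrt r / (1 + r) * (A / τ) := by
    field_simp
  rw [h13] at h12
  nlinarith

/-- The auxiliary energy is positive and decreasing, and its dissipation is bounded. -/
theorem aux_energy_bounds {K : ℕ} {τ γ e D : ℕ → ℝ} (hγ0 : 0 < γ 0)
    (hτ : ∀ n, 1 ≤ n → n ≤ K → 0 < τ n) (he : ∀ n, 0 ≤ e n) (hD : ∀ n, 0 ≤ D n)
    (h : ∀ n, 1 ≤ n → n ≤ K → (γ n - γ (n - 1)) / τ n = -(γ n / (e n + 1)) * D n)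
    (n : ℕ) (hn : n ≤ K) :
    0 < γ n ∧ γ n ≤ γ 0 ∧
      ∑ k ∈ Finset.range n, τ (k + 1) * (γ (k + 1) / (e (k + 1) + 1) * D (k + 1)) = γ 0 - γ n := by
  induction n with
  | zero => simp [hγ0]
  | succ n ih =>
    obtain ⟨ih1, ih2, ih3⟩ := ih (by omega)
    have hτn := hτ (n + 1) (by omega) hn
    have h1 := h (n + 1) (by omega) hn
    rw [div_eq_iff hτn.ne', Nat.add_sub_cancel] at h1
    have hen := he (n + 1)
    have hDn := hD (n + 1)
    -- The implicit treatment of `γ` gives a factor of at least 1, so positivity and decay hold for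
    -- any step size.
    have h2 : γ (n + 1) * (1 + D (n + 1) / (e (n + 1) + 1) * τ (n + 1)) = γ n := by
      have h3 : γ (n + 1) / (e (n + 1) + 1) * D (n + 1)
          = γ (n + 1) * (D (n + 1) / (e (n + 1) + 1)) := by ring
      rw [neg_mul, h3] at h1
      linarith
    have h4 : 0 ≤ D (n + 1) / (e (n + 1) + 1) * τ (n + 1) := by positivity
    have hpos : 0 < γ (n + 1) := by
      by_contra hle
      push Not at hle
      have := mul_nonpos_of_nonpos_of_nonneg hle (by linarith :
        0 ≤ 1 + D (n + 1) / (e (n + 1) + 1) * τ (n + 1))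
      linarith
    refine ⟨hpos, ?_, ?_⟩
    · have := mul_nonneg hpos.le h4
      linarith
    · rw [Finset.sum_range_succ, ih3]
      linarith

/-- A telescoping sum is controlled by its weighted square sum. -/
theorem sob_zero_sub_le {τ : ℕ → ℝ} {m : ℕ} (hτ : ∀ k < m, 0 < τ k) (a : ℕ → (Fin d → ℤ) → ℂ) :
    sob L S 0 (a m - a 0)
      ≤ (∑ k ∈ Finset.range m, τ k) * ∑ k ∈ Finset.range m, sob L S 0 (a (k + 1) - a k) / τ k := by
  have h : ∀ x : Fin d → ℤ, ‖(a m - a 0) x‖ ^ 2 ≤ (∑ k ∈ Finset.range m, τ k) *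
      ∑ k ∈ Finset.range m, ‖(a (k + 1) - a k) x‖ ^ 2 / τ k := by
    intro x
    have h1 : (a m - a 0) x = ∑ k ∈ Finset.range m, (a (k + 1) - a k) x := by
      simp only [Pi.sub_apply]
      rw [Finset.sum_range_sub fun k => a k x]
    rw [h1]
    refine (pow_le_pow_left₀ (norm_nonneg _) (norm_sum_le _ _) 2).trans ?_
    refine Finset.sum_sq_le_sum_mul_sum_of_sq_le_mul _
      (fun k hk => (hτ k (Finset.mem_range.1 hk)).le)
      (fun k hk => div_nonneg (sq_nonneg _) (hτ k (Finset.mem_range.1 hk)).le)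
      (fun k hk => ?_)
    rw [mul_div_cancel₀ _ (hτ k (Finset.mem_range.1 hk)).ne']
  simp only [sob, pow_zero, one_mul]
  refine (Finset.sum_le_sum fun x _ => h x).trans (le_of_eq ?_)
  rw [← Finset.mul_sum, Finset.sum_comm]
  simp only [Finset.sum_div]

end Scheme

/-! ### Uniform bounds for the solution of the scheme -/

/-- The properties of a solution of the scheme that enter the bounds, in terms of the Fourier
coefficients `a n` of `φ̄ⁿ` and `c n` of `φⁿ`; the mesh ratios are bounded by `ρ`, the `H⁴` norm of
the initial value by `C₀`, and the initial auxiliary energy by `Γ`. -/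
structure IsCoefSolution {d : ℕ} (L ε ρ C₀ Γ : ℝ) (S : Finset (Fin d → ℤ)) (K : ℕ) (t : ℕ → ℝ)
    (a c : ℕ → (Fin d → ℤ) → ℂ) (γ ξ η : ℕ → ℝ) : Prop where
  t_zero : t 0 = 0
  step_pos : ∀ n, 1 ≤ n → n ≤ K → 0 < step t n
  ratio_nonneg : ∀ n, 1 ≤ n → n ≤ K → 0 ≤ ratio t n
  ratio_le : ∀ n, 1 ≤ n → n ≤ K → ratio t n ≤ ρ
  init_eq : c 0 = a 0
  init_le : sob L S 4 (a 0) ≤ C₀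
  one_le_gamma : 1 ≤ γ 0
  gamma_le : γ 0 ≤ Γ
  coef_eq : ∀ n, 1 ≤ n → n ≤ K → c n = η n • a n
  aux : ∀ n, 1 ≤ n → n ≤ K →
    (γ n - γ (n - 1)) / step t n = -(γ n / (energy L ε (trig L S (a n)) + 1)) *
      ∑ i, normSq2 L (fun x => -pderiv i (lap (trig L S (a n))) x
        + pderiv i (fun y => nonlin ε (trig L S (extrapCoef t c n) y)) x)
  xi_eq : ∀ n, 1 ≤ n → n ≤ K → ξ n = γ n / (energy L ε (trig L S (a n)) + 1)
  eta_eq : ∀ n, 1 ≤ n → n ≤ K → η n = 1 - (1 - ξ n) ^ 2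
  evolution : ∀ n, 1 ≤ n → n ≤ K →
    inner2 L (bdf2 t (fun m => trig L S (a m)) n) (trig L S (a n - a (n - 1)))
      + inner2 L (lap (lap (trig L S (a n)))) (trig L S (a n - a (n - 1)))
      - inner2 L (lap fun x => nonlin ε (trig L S (extrapCoef t c n) x))
        (trig L S (a n - a (n - 1))) = 0

namespace IsCoefSolution

variable {d : ℕ} {L ε ρ C₀ Γ : ℝ} {S : Finset (Fin d → ℤ)} {K : ℕ} {t : ℕ → ℝ}
  {a c : ℕ → (Fin d → ℤ) → ℂ} {γ ξ η : ℕ → ℝ}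

theorem sum_step (h : IsCoefSolution L ε ρ C₀ Γ S K t a c γ ξ η) (n : ℕ) :
    ∑ k ∈ Finset.range n, step t (k + 1) = t n := by
  simp only [step, Nat.add_sub_cancel]
  rw [Finset.sum_range_sub, h.t_zero, sub_zero]

theorem t_mono (h : IsCoefSolution L ε ρ C₀ Γ S K t a c γ ξ η) {m n : ℕ} (hmn : m ≤ n)
    (hn : n ≤ K) : t m ≤ t n := by
  rw [← h.sum_step m, ← h.sum_step n]
  refine Finset.sum_le_sum_of_subset_of_nonneg (Finset.range_mono hmn) fun k hk _ => ?_
  have := Finset.mem_range.1 hk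
  exact (h.step_pos _ (by omega) (by omega)).le

theorem t_nonneg (h : IsCoefSolution L ε ρ C₀ Γ S K t a c γ ξ η) {n : ℕ} (hn : n ≤ K) :
    0 ≤ t n := by
  simpa [h.t_zero] using h.t_mono (Nat.zero_le n) hn

theorem C₀_nonneg (h : IsCoefSolution L ε ρ C₀ Γ S K t a c γ ξ η) : 0 ≤ C₀ :=
  (sob_nonneg L S 4 _).trans h.init_le

theorem step_succ_le (h : IsCoefSolution L ε ρ C₀ Γ S K t a c γ ξ η) (k : ℕ) (hk : k + 1 < K) :
    step t (k + 1 + 1) ≤ ρ * step t (k + 1) := by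
  have h1 := h.ratio_le (k + 1 + 1) (by omega) hk
  rw [ratio, if_neg (by omega), div_le_iff₀ (h.step_pos _ (by omega) (by omega))] at h1
  exact h1

theorem gamma_bounds (h : IsCoefSolution L ε ρ C₀ Γ S K t a c γ ξ η) {n : ℕ} (hn : n ≤ K) :
    0 < γ n ∧ γ n ≤ γ 0 ∧
      ∑ k ∈ Finset.range n, step t (k + 1) * (ξ (k + 1) *
        ∑ i, normSq2 L (fun x => -pderiv i (lap (trig L S (a (k + 1)))) x
          + pderiv i (fun y => nonlin ε (trig L S (extrapCoef t c (k + 1)) y)) x)) ≤ Γ := by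
  have h1 := aux_energy_bounds (lt_of_lt_of_le one_pos h.one_le_gamma) h.step_pos
    (fun n => energy_nonneg L ε (trig L S (a n)))
    (fun n => Finset.sum_nonneg fun i _ => normSq2_nonneg L _) h.aux n hn
  refine ⟨h1.1, h1.2.1, ?_⟩
  refine le_trans (le_of_eq ?_) (h1.2.2.le.trans (by linarith [h1.1, h.gamma_le]))
  refine Finset.sum_congr rfl fun k hk => ?_
  have := Finset.mem_range.1 hk
  rw [h.xi_eq (k + 1) (by omega) (by omega)]

/-- As `E ≥ 0`, `ξ` lies between 0 and `γ⁰`, and `η = ξ (2 - ξ)`. The factor `ξ` is kept in the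
bound for `η` because it is what compensates the energy and the dissipation of `φ̄ⁿ`. -/
theorem xi_bounds (h : IsCoefSolution L ε ρ C₀ Γ S K t a c γ ξ η) {n : ℕ} (hn1 : 1 ≤ n)
    (hn : n ≤ K) :
    0 < ξ n ∧ ξ n ≤ γ 0 ∧ ξ n * (energy L ε (trig L S (a n)) + 1) ≤ γ 0 ∧
      |η n| ≤ ξ n * (2 + γ 0) := by
  obtain ⟨hpos, hle, -⟩ := h.gamma_bounds hn
  have hE := energy_nonneg L ε (trig L S (a n))
  have hx := h.xi_eq n hn1 hn
  have h1 : ξ n * (energy L ε (trig L S (a n)) + 1) = γ n := by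
    rw [hx]; field_simp
  have h0 : 0 < ξ n := by rw [hx]; positivity
  have h2 : ξ n ≤ γ 0 := by nlinarith
  refine ⟨h0, h2, h1.le.trans hle, ?_⟩
  rw [h.eta_eq n hn1 hn, abs_le]
  constructor <;> nlinarith

theorem eta_sq_le (h : IsCoefSolution L ε ρ C₀ Γ S K t a c γ ξ η) {n : ℕ} (hn1 : 1 ≤ n)
    (hn : n ≤ K) : η n ^ 2 ≤ ξ n * Γ * (2 + Γ) ^ 2 := by
  obtain ⟨h0, h1, -, h3⟩ := h.xi_bounds hn1 hn
  rw [← sq_abs]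
  calc |η n| ^ 2 ≤ (ξ n * (2 + γ 0)) ^ 2 := pow_le_pow_left₀ (abs_nonneg _) h3 2
    _ = ξ n * ξ n * (2 + γ 0) ^ 2 := by ring
    _ ≤ ξ n * Γ * (2 + Γ) ^ 2 := by
      have h5 : 0 ≤ 2 + γ 0 := by linarith [h.one_le_gamma]
      have h6 : ξ n ≤ Γ := h1.trans h.gamma_le
      have h7 := h.gamma_le
      have h8 : 0 ≤ Γ := h0.le.trans h6
      gcongr

theorem abs_eta_le (h : IsCoefSolution L ε ρ C₀ Γ S K t a c γ ξ η) {n : ℕ} (hn1 : 1 ≤ n)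
    (hn : n ≤ K) : |η n| ≤ γ 0 * (2 + γ 0) := by
  obtain ⟨h0, h1, -, h3⟩ := h.xi_bounds hn1 hn
  exact h3.trans (mul_le_mul_of_nonneg_right h1 (by linarith))

/-- Each `φⁿ` is a bounded multiple of `φ̄ⁿ`. -/
theorem exists_coef_eq (h : IsCoefSolution L ε ρ C₀ Γ S K t a c γ ξ η) {n : ℕ} (hn : n ≤ K) :
    ∃ r : ℝ, |r| ≤ γ 0 * (2 + γ 0) ∧ c n = r • a n := by
  rcases Nat.eq_zero_or_pos n with rfl | hn1
  · refine ⟨1, ?_, by rw [h.init_eq, one_smul]⟩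
    have := h.one_le_gamma
    rw [abs_one]
    nlinarith
  · exact ⟨η n, h.abs_eta_le hn1 hn, h.coef_eq n hn1 hn⟩

theorem sob_coef_le (h : IsCoefSolution L ε ρ C₀ Γ S K t a c γ ξ η) (m : ℕ) {n : ℕ} (hn : n ≤ K) :
    sob L S m (c n) ≤ (Γ * (2 + Γ)) ^ 2 * sob L S m (a n) := by
  obtain ⟨r, hr, hc⟩ := h.exists_coef_eq hn
  rw [hc, sob_smul, ← sq_abs r]
  have h1 := h.one_le_gamma
  have h2 := h.gamma_le
  have h3 : 0 ≤ Γ := by linarith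
  have : |r| ≤ Γ * (2 + Γ) := hr.trans (by gcongr)
  exact mul_le_mul_of_nonneg_right (pow_le_pow_left₀ (abs_nonneg _) this 2) (sob_nonneg _ _ _ _)

/-- The factor `η² ≤ C ξ` cancels the energy in the H¹ bound of `φ̄ⁿ`, through `ξ (E + 1) ≤ γ⁰`. The
term `C₀` is for the initial value, which carries no factor `η`. -/
theorem sob_one_coef_le (h : IsCoefSolution L ε ρ C₀ Γ S K t a c γ ξ η) (hL : 0 < L) (hε : 0 < ε)
    {n : ℕ} (hn : n ≤ K) :
    sob L S 1 (c n)
      ≤ C₀ + Γ ^ 2 * (2 + Γ) ^ 2 * (3 + L ^ d * (1 + ε ^ 2)) / L ^ d := by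
  have hω : 0 < L ^ d := pow_pos hL d
  have hΓ : 1 ≤ Γ := h.one_le_gamma.trans h.gamma_le
  have hC := h.C₀_nonneg
  rcases Nat.eq_zero_or_pos n with rfl | hn1
  · have : 0 ≤ Γ ^ 2 * (2 + Γ) ^ 2 * (3 + L ^ d * (1 + ε ^ 2)) / L ^ d := by positivity
    have h1 := (sob_mono (L := L) (S := S) (show 1 ≤ 4 by norm_num) (a 0)).trans h.init_le
    rw [h.init_eq]
    linarith
  · obtain ⟨h0, h1, h2, h3⟩ := h.xi_bounds hn1 hn
    have hE := energy_nonneg L ε (trig L S (a n))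
    have hγ := h.gamma_le
    have h4 := h.eta_sq_le hn1 hn
    have h5 : L ^ d * sob L S 1 (c n)
        ≤ Γ ^ 2 * (2 + Γ) ^ 2 * (3 + L ^ d * (1 + ε ^ 2)) := by
      rw [h.coef_eq n hn1 hn, sob_smul, mul_left_comm]
      calc η n ^ 2 * (L ^ d * sob L S 1 (a n))
          ≤ (ξ n * Γ * (2 + Γ) ^ 2) *
            ((3 + L ^ d * (1 + ε ^ 2)) * (energy L ε (trig L S (a n)) + 1)) := by
            refine mul_le_mul h4 (sob_one_le_energy hL hε _) ?_ (by positivity)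
            exact mul_nonneg hω.le (sob_nonneg _ _ _ _)
        _ = (ξ n * (energy L ε (trig L S (a n)) + 1)) *
            (Γ * (2 + Γ) ^ 2 * (3 + L ^ d * (1 + ε ^ 2))) := by ring
        _ ≤ Γ * (Γ * (2 + Γ) ^ 2 * (3 + L ^ d * (1 + ε ^ 2))) :=
            mul_le_mul_of_nonneg_right (h2.trans hγ) (by positivity)
        _ = _ := by ring
    have h6 := (le_div_iff₀' hω).2 h5
    linarith

theorem sob_extrap_le (h : IsCoefSolution L ε ρ C₀ Γ S K t a c γ ξ η) (hρ : ρ ≤ rMax) (m : ℕ)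
    {k : ℕ} (hk : k < K) :
    sob L S m (extrapCoef t c (k + 1))
      ≤ 2 * (1 + rMax) ^ 2 * (sob L S m (c k) + sob L S m (c (k - 1))) :=
  sob_extrapCoef_le (h.ratio_nonneg _ (by omega) (by omega))
    ((h.ratio_le _ (by omega) (by omega)).trans hρ) m c

end IsCoefSolution

/-! ### The time-integrated H³ bound and the H² bound -/

section Bounds

variable {d : ℕ} {L ε ρ C₀ Γ : ℝ}

theorem gradNormSq_lap_smul_trig {S : Finset (Fin d → ℤ)} (hL : 0 < L) (r : ℝ)
    (c : (Fin d → ℤ) → ℂ) :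
    gradNormSq L (lap (trig L S (r • c))) = r ^ 2 * gradNormSq L (lap (trig L S c)) := by
  rw [gradNormSq_lap_trig hL, gradNormSq_lap_trig hL, mul_left_comm, Finset.mul_sum _ _ (r ^ 2)]
  congr 1
  refine Finset.sum_congr rfl fun k _ => ?_
  simp only [Pi.smul_apply, norm_smul, mul_pow, Real.norm_eq_abs, sq_abs]
  ring

/-- Triangle inequality isolating `∇Δφ̄ⁿ` in the dissipation, at the expense of the gradient of the
nonlinearity. -/
theorem gradNormSq_lap_le {S : Finset (Fin d → ℤ)} (ε : ℝ) (a e : (Fin d → ℤ) → ℂ) :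
    gradNormSq L (lap (trig L S a))
      ≤ 2 * ∑ i, normSq2 L (fun x => -pderiv i (lap (trig L S a)) x
          + pderiv i (fun y => nonlin ε (trig L S e y)) x)
        + 2 * gradNormSq L (fun y => nonlin ε (trig L S e y)) := by
  rw [gradNormSq, gradNormSq, Finset.mul_sum, Finset.mul_sum, ← Finset.sum_add_distrib]
  refine Finset.sum_le_sum fun i _ => ?_
  have h1 : Continuous (pderiv i (lap (trig L S a))) := by
    rw [lap_trig]; exact continuous_pderiv_trig i _
  have h2 : Continuous (pderiv i (fun y => nonlin ε (trig L S e y))) := by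
    have hu : Continuous (trig L S e) := continuous_trig e
    have hp : Continuous (pderiv i (trig L S e)) := continuous_pderiv_trig i e
    rw [pderiv_nonlin (differentiable_trig e)]
    fun_prop
  set p := pderiv i (lap (trig L S a))
  set q := pderiv i (fun y => nonlin ε (trig L S e y))
  have h3 : Continuous fun x => p x - q x := h1.sub h2
  have h4 := normSq2_add_le (L := L) h3 h2
  have h5 : normSq2 L (fun x => p x - q x) = normSq2 L (fun x => -p x + q x) := by
    simp only [normSq2]
    congr 1
    funext x
    rw [← norm_neg]
    congr 2
    ring
  simp only [sub_add_cancel] at h4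
  rw [h5] at h4
  exact h4

/-- The time integral of the squared `H³` norm of the extrapolated solution grows at most
linearly. -/
theorem exists_sum_sob_three_le (hd : d < 4) (hL : 0 < L) (hε : 0 < ε) (hρ0 : 0 ≤ ρ)
    (hρ : ρ ≤ rMax) (hC₀ : 0 ≤ C₀) (hΓ : 1 ≤ Γ) :
    ∃ α β : ℝ, 0 ≤ α ∧ 0 ≤ β ∧ ∀ (S : Finset (Fin d → ℤ)) (K : ℕ) (t : ℕ → ℝ)
      (a c : ℕ → (Fin d → ℤ) → ℂ) (γ ξ η : ℕ → ℝ),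
      IsCoefSolution L ε ρ C₀ Γ S K t a c γ ξ η → ∀ n ≤ K,
        ∑ k ∈ Finset.range n, step t (k + 1) * (1 + sob L S 3 (extrapCoef t c (k + 1)))
          ≤ α + β * t n := by
  set ω := L ^ d with hω_def
  have hω : 0 < ω := pow_pos hL d
  set M := C₀ + Γ ^ 2 * (2 + Γ) ^ 2 * (3 + ω * (1 + ε ^ 2)) / ω with hM
  have hM0 : 0 ≤ M := by positivity
  set B := 2 * (1 + rMax) ^ 2 with hB
  have hB0 : 0 < B := by have := four_le_rMax; positivity
  set H := (Γ * (2 + Γ)) ^ 2 with hH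
  have hH0 : 0 < H := by positivity
  -- Chosen so that the final delay coefficient `θ` equals `1 / (2 (ρ + ρ² + 1))`, small enough for
  -- absorption.
  set θ₁ := ω / (16 * H * B * (ρ + ρ ^ 2 + 1)) with hθ₁
  have hθ₁0 : 0 < θ₁ := by positivity
  obtain ⟨C₁, hC₁, hgrad⟩ := exists_gradNormSq_nonlin_le hd hL hε
    (M := B * (2 * M)) (by positivity) hθ₁0
  set θ := 8 * H / ω * θ₁ * B with hθ
  have hθ0 : 0 ≤ θ := by positivity
  have hθρ : θ * (ρ + ρ ^ 2) ≤ 1 / 2 := by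
    have : θ = 1 / (2 * (ρ + ρ ^ 2 + 1)) := by
      rw [hθ, hθ₁]; field_simp; norm_num
    rw [this, div_mul_eq_mul_div, div_le_div_iff₀ (by positivity) (by norm_num)]
    linarith
  set C₂ := 4 * M + 8 * H / ω * C₁ with hC₂
  set C₃ := 8 / ω * (Γ * (2 + Γ) ^ 2) with hC₃
  have hC₂0 : 0 ≤ C₂ := by positivity
  have hC₃0 : 0 ≤ C₃ := by positivity
  refine ⟨B * ((ρ + ρ ^ 2) * (2 * (C₃ * Γ))),
    1 + B * ((2 + ρ) * C₀ + (ρ + ρ ^ 2) * (2 * (C₂ + θ * (2 + ρ) * C₀))),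
    by positivity, by positivity, fun S K t a c γ ξ η h n hn => ?_⟩
  have ht0 := h.t_nonneg hn
  -- Truncation at 0 makes the weights nonnegative for every index; the mesh is unconstrained beyond
  -- `K`.
  set τ : ℕ → ℝ := fun k => max (step t (k + 1)) 0 with hτ_def
  have hτ0 : ∀ k, 0 ≤ τ k := fun k => le_max_right _ _
  have hτ : ∀ k < n, τ k = step t (k + 1) := fun k hk =>
    max_eq_left (h.step_pos _ (by omega) (by omega)).le
  have hratio : ∀ k, k + 1 < n → τ (k + 1) ≤ ρ * τ k := fun k hk => by
    rw [hτ _ hk, hτ _ (by omega)]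
    exact h.step_succ_le k (by omega)
  set D : ℕ → ℝ := fun k => ∑ i, normSq2 L (fun x => -pderiv i (lap (trig L S (a k))) x
          + pderiv i (fun y => nonlin ε (trig L S (extrapCoef t c k) y)) x) with hD
  have hX : ∀ k, 0 ≤ sob L S 3 (c k) := fun k => sob_nonneg _ _ _ _
  -- On the dissipation the sharp bound `η² ≤ ξ Γ (2 + Γ)²` is used, to keep the summable factor
  -- `ξ`; on the nonlinearity the crude bound `η² ≤ H` suffices.
  have hdelay : ∀ k < n, sob L S 3 (c (k + 1)) ≤ C₃ * (ξ (k + 1) * D (k + 1)) + C₂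
      + θ * (sob L S 3 (c k) + sob L S 3 (c (k - 1))) := by
    intro k hk
    have he1 : sob L S 1 (extrapCoef t c (k + 1)) ≤ B * (2 * M) := by
      refine (h.sob_extrap_le hρ 1 (by omega)).trans (mul_le_mul_of_nonneg_left ?_ hB0.le)
      have h1 := h.sob_one_coef_le hL hε (n := k) (by omega)
      have h2 := h.sob_one_coef_le hL hε (n := k - 1) (by omega)
      linarith
    have he3 := h.sob_extrap_le hρ 3 (k := k) (by omega)
    have hg := hgrad S _ he1
    have hg2 := gradNormSq_lap_le (L := L) (S := S) ε (a (k + 1)) (extrapCoef t c (k + 1))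
    have hη := h.eta_sq_le (n := k + 1) (by omega) (by omega)
    have hD0 : 0 ≤ D (k + 1) := Finset.sum_nonneg fun i _ => normSq2_nonneg _ _
    have hηH : η (k + 1) ^ 2 ≤ H := by
      have h1 := h.xi_bounds (n := k + 1) (by omega) (by omega)
      have h2 : ξ (k + 1) ≤ Γ := h1.2.1.trans h.gamma_le
      have h3 : ξ (k + 1) * Γ * (2 + Γ) ^ 2 ≤ Γ * Γ * (2 + Γ) ^ 2 := by gcongr
      rw [hH]
      linarith
    have h3 := sob_three_le (S := S) hL (c (k + 1))
    have h0 : normSq2 L (trig L S (c (k + 1))) ≤ ω * M := by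
      rw [normSq2_trig_eq_sob hL]
      exact mul_le_mul_of_nonneg_left ((sob_mono (by norm_num) _).trans
        (h.sob_one_coef_le hL hε (by omega))) hω.le
    have h4 : gradNormSq L (lap (trig L S (c (k + 1))))
        ≤ 2 * (ξ (k + 1) * Γ * (2 + Γ) ^ 2 * D (k + 1))
          + 2 * (H * (θ₁ * (B * (sob L S 3 (c k) + sob L S 3 (c (k - 1)))) + C₁)) := by
      rw [h.coef_eq (k + 1) (by omega) (by omega), gradNormSq_lap_smul_trig hL]
      have h5 := mul_le_mul_of_nonneg_left hg2 (sq_nonneg (η (k + 1)))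
      have h6 := mul_le_mul_of_nonneg_right hη hD0
      have h7 := mul_le_mul hηH (hg.trans (add_le_add_left
        (mul_le_mul_of_nonneg_left he3 hθ₁0.le) C₁)) (gradNormSq_nonneg _ _) hH0.le
      linarith
    have h8 : ω * sob L S 3 (c (k + 1)) ≤ ω * (C₃ * (ξ (k + 1) * D (k + 1)) + C₂
      + θ * (sob L S 3 (c k) + sob L S 3 (c (k - 1)))) := by
      refine h3.trans ((mul_le_mul_of_nonneg_left (add_le_add h0 h4) (by norm_num)).trans
        (le_of_eq ?_))
      rw [hC₃, hC₂, hθ]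
      field_simp
      ring
    exact le_of_mul_le_mul_left h8 hω
  have hsum := sum_step_le_of_delay (P := fun k => C₃ * (ξ (k + 1) * D (k + 1))) hX hτ0 hρ0 hratio
    hθ0 hθρ hdelay
  have hdel := sum_step_mul_delay_le hX hτ0 hρ0 hratio
  have hP : ∑ k ∈ Finset.range n, τ k * (C₃ * (ξ (k + 1) * D (k + 1))) ≤ C₃ * Γ := by
    refine le_trans (le_of_eq ?_) (mul_le_mul_of_nonneg_left (h.gamma_bounds hn).2.2 hC₃0)
    rw [Finset.mul_sum]
    refine Finset.sum_congr rfl fun k hk => ?_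
    rw [hτ k (Finset.mem_range.1 hk)]
    ring
  have hT : ∑ k ∈ Finset.range n, τ k = t n := by
    rw [← h.sum_step n]
    exact Finset.sum_congr rfl fun k hk => hτ k (Finset.mem_range.1 hk)
  rcases Nat.eq_zero_or_pos n with rfl | hn0
  · simp only [Finset.range_zero, Finset.sum_empty]
    positivity
  have hτ0t : τ 0 * sob L S 3 (c 0) ≤ t n * C₀ := by
    refine mul_le_mul ?_ ?_ (hX 0) ht0
    · rw [← hT]
      exact Finset.single_le_sum (f := τ) (fun k _ => hτ0 k) (Finset.mem_range.2 hn0)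
    · rw [h.init_eq]
      exact (sob_mono (by norm_num) _).trans h.init_le
  have hE : ∑ k ∈ Finset.range n, step t (k + 1) * (1 + sob L S 3 (extrapCoef t c (k + 1)))
      ≤ t n + B * ∑ k ∈ Finset.range n, τ k * (sob L S 3 (c k) + sob L S 3 (c (k - 1))) := by
    rw [← hT, Finset.mul_sum, ← Finset.sum_add_distrib]
    refine Finset.sum_le_sum fun k hk => ?_
    have hk' := Finset.mem_range.1 hk
    have := mul_le_mul_of_nonneg_left (h.sob_extrap_le hρ 3 (k := k) (by omega)) (hτ0 k)
    rw [hτ k hk'] at *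
    linarith
  rw [hT] at hsum
  have h10 : 0 ≤ ρ + ρ ^ 2 := by positivity
  have h11 := mul_le_mul_of_nonneg_left hτ0t (by positivity : 0 ≤ θ * (2 + ρ))
  have h12 := mul_le_mul_of_nonneg_left hτ0t (by positivity : 0 ≤ 2 + ρ)
  have h13 : ∑ k ∈ Finset.range n, τ k * sob L S 3 (c (k + 1))
      ≤ 2 * (C₃ * Γ + C₂ * t n + θ * (2 + ρ) * (t n * C₀)) := by linarith
  have h14 := mul_le_mul_of_nonneg_left h13 h10
  have h15 : ∑ k ∈ Finset.range n, τ k * (sob L S 3 (c k) + sob L S 3 (c (k - 1)))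
      ≤ (2 + ρ) * (t n * C₀)
        + (ρ + ρ ^ 2) * (2 * (C₃ * Γ + C₂ * t n + θ * (2 + ρ) * (t n * C₀))) := by linarith
  have h16 := mul_le_mul_of_nonneg_left h15 hB0.le
  refine hE.trans ?_
  linarith

/-- The squared `H²` norm of `φ̄ⁿ` is bounded by an increasing function of the time. -/
theorem exists_sob_two_le (hd : d < 4) (hL : 0 < L) (hε : 0 < ε) (hρ0 : 0 ≤ ρ)
    (hρ : ρ < rMax) (hC₀ : 0 ≤ C₀) (hΓ : 1 ≤ Γ) :
    ∃ R : ℝ → ℝ, (∀ s, 0 ≤ s → 0 ≤ R s) ∧ (∀ s s', 0 ≤ s → s ≤ s' → R s ≤ R s') ∧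
      ∀ (S : Finset (Fin d → ℤ)) (K : ℕ) (t : ℕ → ℝ)
      (a c : ℕ → (Fin d → ℤ) → ℂ) (γ ξ η : ℕ → ℝ),
      IsCoefSolution L ε ρ C₀ Γ S K t a c γ ξ η → ∀ n ≤ K, sob L S 2 (a n) ≤ R (t n) := by
  obtain ⟨α, β, hα, hβ, hsum⟩ := exists_sum_sob_three_le hd hL hε hρ0 hρ.le hC₀ hΓ
  obtain ⟨g, κ, hg, hκ, hker⟩ := exists_bdf_const hρ0 hρ
  set ω := L ^ d with hω_def
  have hω : 0 < ω := pow_pos hL d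
  set M := C₀ + Γ ^ 2 * (2 + Γ) ^ 2 * (3 + ω * (1 + ε ^ 2)) / ω with hM
  have hM0 : 0 ≤ M := by positivity
  set B := 2 * (1 + rMax) ^ 2 with hB
  have hB0 : 0 < B := by have := four_le_rMax; positivity
  set H := (Γ * (2 + Γ)) ^ 2 with hH
  have hH0 : 0 < H := by positivity
  obtain ⟨CF, hCF, hlap⟩ := exists_normSq2_lap_nonlin_le hd hL hε
    (M := B * (2 * M)) (by positivity)
  -- `A` collects the initial data and `q` the Gronwall coefficient. The recurring `4 s / κ + 2`
  -- combines the L² part, recovered over a time `s`, with the bound on the Laplacian.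
  set A : ℝ → ℝ := fun s => 4 * C₀ + (4 * s / κ + 2) * C₀ with hA
  set q : ℝ → ℝ := fun s => (4 * s / κ + 2) / (ω * κ) * (CF * B * H) with hq
  have hA0 : ∀ s, 0 ≤ s → 0 ≤ A s := fun s hs => by simp only [hA]; positivity
  have hq0 : ∀ s, 0 ≤ s → 0 ≤ q s := fun s hs => by simp only [hq]; positivity
  refine ⟨fun s => A s * Real.exp (2 * q s * (α + β * s)), fun s hs =>
    mul_nonneg (hA0 s hs) (Real.exp_pos _).le, fun s s' hs hss => ?_, ?_⟩
  · have hs' : 0 ≤ s' := hs.trans hss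
    have h1 : A s ≤ A s' := by simp only [hA]; gcongr
    have h2 : q s ≤ q s' := by simp only [hq]; gcongr
    have h3 := hq0 s hs
    have h4 := hq0 s' hs'
    have h5 := hA0 s' hs'
    simp only
    gcongr
  intro S K t a c γ ξ η h n hn
  have ht0 := h.t_nonneg hn
  set T := t n with hT
  set Y : ℕ → ℝ := fun k => normSq2 L (trig L S (a k - a (k - 1))) / step t k with hY
  set Z : ℕ → ℝ := fun k => normSq2 L (lap (trig L S (a k))) with hZ
  set F : ℕ → ℝ := fun k => normSq2 L (lap fun x => nonlin ε (trig L S (extrapCoef t c k) x))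
    with hF
  -- The fictitious step of index 0 has length 0, and division by zero makes `Y 0` vanish, so the
  -- telescoping starts with no history term.
  have hY0 : Y 0 = 0 := by simp [hY, step]
  have hYn : ∀ k ≤ K, 0 ≤ Y k := fun k hk => by
    rcases Nat.eq_zero_or_pos k with rfl | hk0
    · exact hY0.ge
    · exact div_nonneg (normSq2_nonneg _ _) (h.step_pos k hk0 hk).le
  have hstep : ∀ k, 1 ≤ k → k ≤ K →
      (g + κ) * Y k + Z k ≤ g * Y (k - 1) + Z (k - 1) + step t k / κ * F k := by
    intro k hk1 hk
    obtain ⟨h1, h2⟩ := hker _ (h.ratio_nonneg k hk1 hk) (h.ratio_le k hk1 hk)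
    exact bdf2_step_estimate hL hκ hk1 (h.step_pos k hk1 hk)
      (fun h2 => h.step_pos _ (by omega) (by omega)) (h.ratio_nonneg k hk1 hk) h1 h2 a
      (continuous_lap_nonlin_trig _ ε) (h.evolution k hk1 hk)
  have hsumstep : ∀ m ≤ K, g * Y m + Z m + κ * ∑ k ∈ Finset.range m, Y (k + 1)
      ≤ Z 0 + ∑ k ∈ Finset.range m, step t (k + 1) / κ * F (k + 1) := by
    intro m hm
    induction m with
    | zero => simp [hY0]
    | succ m ih =>
      have h1 := ih (by omega)
      have h2 := hstep (m + 1) (by omega) hm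
      rw [Nat.add_sub_cancel] at h2
      rw [Finset.sum_range_succ, Finset.sum_range_succ]
      linarith
  have hZ0 : Z 0 ≤ ω * C₀ := (normSq2_lap_trig_le hL _).trans
    (mul_le_mul_of_nonneg_left ((sob_mono (by norm_num) _).trans h.init_le) hω.le)
  -- The coefficient is frozen at the final time `T`, so that one set of weights serves all `m ≤ n`.
  set μ : ℕ → ℝ := fun k => q T * (max (step t (k + 1)) 0 *
    (1 + sob L S 3 (extrapCoef t c (k + 1)))) with hμ
  have hμ0 : ∀ k, 0 ≤ μ k := fun k => mul_nonneg (hq0 T ht0)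
    (mul_nonneg (le_max_right _ _) (by linarith [sob_nonneg L S 3 (extrapCoef t c (k + 1))]))
  have hFk : ∀ k < K, F (k + 1) ≤ CF * B * H * ((1 + sob L S 3 (extrapCoef t c (k + 1))) *
      (sob L S 2 (a k) + sob L S 2 (a (k - 1)))) := by
    intro k hk
    have he1 : sob L S 1 (extrapCoef t c (k + 1)) ≤ B * (2 * M) := by
      refine (h.sob_extrap_le hρ.le 1 (by omega)).trans (mul_le_mul_of_nonneg_left ?_ hB0.le)
      have h1 := h.sob_one_coef_le hL hε (n := k) (by omega)
      have h2 := h.sob_one_coef_le hL hε (n := k - 1) (by omega)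
      linarith
    have he2 : sob L S 2 (extrapCoef t c (k + 1))
        ≤ B * (H * (sob L S 2 (a k) + sob L S 2 (a (k - 1)))) := by
      refine (h.sob_extrap_le hρ.le 2 (by omega)).trans (mul_le_mul_of_nonneg_left ?_ hB0.le)
      have h1 := h.sob_coef_le 2 (n := k) (by omega)
      have h2 := h.sob_coef_le 2 (n := k - 1) (by omega)
      linarith
    have h3 := sob_nonneg L S 3 (extrapCoef t c (k + 1))
    calc F (k + 1) ≤ CF * (1 + sob L S 3 (extrapCoef t c (k + 1)))
          * sob L S 2 (extrapCoef t c (k + 1)) := hlap S _ he1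
      _ ≤ CF * (1 + sob L S 3 (extrapCoef t c (k + 1)))
          * (B * (H * (sob L S 2 (a k) + sob L S 2 (a (k - 1))))) := by gcongr
      _ = _ := by ring
  have hgron : ∀ m ≤ n, sob L S 2 (a m) ≤ A T + ∑ k ∈ Finset.range m,
      μ k * (sob L S 2 (a k) + sob L S 2 (a (k - 1))) := by
    intro m hm
    have hmK : m ≤ K := hm.trans hn
    set W := ω * C₀ + ∑ k ∈ Finset.range m, step t (k + 1) / κ * F (k + 1) with hW
    have h1 := hsumstep m hmK
    have hYm := mul_nonneg hg (hYn m hmK)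
    have hZm : 0 ≤ Z m := normSq2_nonneg _ _
    have hYs : 0 ≤ ∑ k ∈ Finset.range m, Y (k + 1) := Finset.sum_nonneg fun k hk =>
      hYn _ (by have := Finset.mem_range.1 hk; omega)
    have hYW : ∑ k ∈ Finset.range m, Y (k + 1) ≤ W / κ := by
      rw [le_div_iff₀ hκ]; linarith
    have hZW : Z m ≤ W := by nlinarith
    have hW0 : 0 ≤ W := hZm.trans hZW
    -- The Laplacian does not see the mean. The L² norm is recovered from the increments by
    -- Cauchy–Schwarz in time, using the surplus `κ ∑ Y`; this brings in the factor `T`.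
    have h2 := sob_zero_sub_le (L := L) (S := S) (τ := fun k => step t (k + 1)) (m := m)
      (fun k hk => h.step_pos _ (by omega) (by omega)) a
    rw [h.sum_step] at h2
    have h3 : ω * ∑ k ∈ Finset.range m, sob L S 0 (a (k + 1) - a k) / step t (k + 1)
        = ∑ k ∈ Finset.range m, Y (k + 1) := by
      rw [Finset.mul_sum]
      refine Finset.sum_congr rfl fun k _ => ?_
      simp only [hY, Nat.add_sub_cancel, normSq2_trig_eq_sob hL]
      ring
    have h4 : ω * sob L S 0 (a m - a 0) ≤ T * (W / κ) := by
      calc ω * sob L S 0 (a m - a 0) ≤ ω * (t m *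
            ∑ k ∈ Finset.range m, sob L S 0 (a (k + 1) - a k) / step t (k + 1)) :=
            mul_le_mul_of_nonneg_left h2 hω.le
        _ = t m * ∑ k ∈ Finset.range m, Y (k + 1) := by rw [mul_left_comm, h3]
        _ ≤ T * (W / κ) := mul_le_mul (h.t_mono hm hn) hYW hYs ht0
    have h5 : sob L S 0 (a m) ≤ 2 * sob L S 0 (a m - a 0) + 2 * C₀ := by
      have h6 := sob_sub_le (L := L) (S := S) 0 (a m - a 0) ((-1 : ℝ) • a 0)
      rw [sob_smul] at h6
      have h7 : a m - a 0 - (-1 : ℝ) • a 0 = a m := by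
        rw [neg_smul, one_smul, sub_neg_eq_add, sub_add_cancel]
      rw [h7] at h6
      have h8 := (sob_mono (L := L) (S := S) (show 0 ≤ 4 by norm_num) (a 0)).trans h.init_le
      linarith
    have h6 := sob_two_le (S := S) hL (a m)
    rw [normSq2_trig_eq_sob hL] at h6
    have h7 : ω * sob L S 2 (a m) ≤ 4 * (ω * C₀) + (4 * T / κ + 2) * W := by
      have h8 := mul_le_mul_of_nonneg_left h5 hω.le
      have h9 : (4 * T / κ + 2) * W = 4 * (T * (W / κ)) + 2 * W := by field_simp
      rw [h9]
      linarith
    have h8 : ∑ k ∈ Finset.range m, step t (k + 1) / κ * F (k + 1)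
        ≤ CF * B * H / κ * ∑ k ∈ Finset.range m, max (step t (k + 1)) 0 *
          ((1 + sob L S 3 (extrapCoef t c (k + 1))) *
            (sob L S 2 (a k) + sob L S 2 (a (k - 1)))) := by
      rw [Finset.mul_sum]
      refine Finset.sum_le_sum fun k hk => ?_
      have hk' := Finset.mem_range.1 hk
      have hs := (h.step_pos (k + 1) (by omega) (by omega)).le
      rw [max_eq_left hs]
      refine (mul_le_mul_of_nonneg_left (hFk k (by omega)) (by positivity)).trans (le_of_eq ?_)
      ring
    have h9 : ∑ k ∈ Finset.range m, μ k * (sob L S 2 (a k) + sob L S 2 (a (k - 1)))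
        = q T * ∑ k ∈ Finset.range m, max (step t (k + 1)) 0 *
          ((1 + sob L S 3 (extrapCoef t c (k + 1))) *
            (sob L S 2 (a k) + sob L S 2 (a (k - 1)))) := by
      rw [Finset.mul_sum]
      refine Finset.sum_congr rfl fun k _ => ?_
      simp only [hμ]
      ring
    rw [h9]
    refine le_of_mul_le_mul_left (h7.trans ?_) hω
    have hc0 : 0 ≤ 4 * T / κ + 2 := by positivity
    refine (add_le_add_right (mul_le_mul_of_nonneg_left (add_le_add_right h8 _) hc0) _).trans
      (le_of_eq ?_)
    simp only [hA, hq]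
    field_simp
    ring
  refine (le_mul_exp_of_delay (hA0 T ht0) hμ0 hgron n le_rfl).trans ?_
  refine mul_le_mul_of_nonneg_left (Real.exp_le_exp.2 ?_) (hA0 T ht0)
  rw [← Finset.mul_sum, mul_assoc]
  refine mul_le_mul_of_nonneg_left ?_ (by norm_num)
  simp only [hμ]
  rw [← Finset.mul_sum]
  refine mul_le_mul_of_nonneg_left (le_trans (le_of_eq ?_) (hsum S K t a c γ ξ η h n hn))
    (hq0 T ht0)
  refine Finset.sum_congr rfl fun k hk => ?_
  have := Finset.mem_range.1 hk
  rw [max_eq_left (h.step_pos (k + 1) (by omega) (by omega)).le]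

end Bounds

/-! ### Sup bounds on the nonlinearity, and reduction to coefficients -/

section Main

variable {d : ℕ} {L ε : ℝ}

theorem normLinf_le {u : (Fin d → ℝ) → ℂ} {C : ℝ} (h : ∀ x, ‖u x‖ ≤ C) :
    normLinf L u ≤ ENNReal.ofReal C := by
  rw [normLinf, eLpNorm_exponent_top]
  exact eLpNormEssSup_le_of_ae_bound (ae_of_all _ h)

/-- The polynomial bounding the three quantities has no `ε`, so `ε⁻²` must be hidden in `y`. One
factor `|z|` absorbs it in `f` and `f''` and in the quadratic term of `f'`; the constant term of
`f'` is what requires `1 / ε² ≤ y`. -/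
theorem norm_nonlin_bounds {y : ℝ} {z : ℂ} (hy : 0 ≤ y) (hνy : 1 / ε ^ 2 ≤ y)
    (hz : (1 + 1 / ε ^ 2) * ‖z‖ ≤ y) :
    ‖nonlin ε z‖ ≤ y ^ 3 + 3 * y ^ 2 + 6 * y + 1 ∧
      ‖deriv (nonlin ε) z‖ ≤ y ^ 3 + 3 * y ^ 2 + 6 * y + 1 ∧
      ‖deriv (deriv (nonlin ε)) z‖ ≤ y ^ 3 + 3 * y ^ 2 + 6 * y + 1 := by
  have hνnorm : ‖1 / (ε : ℂ) ^ 2‖ = 1 / ε ^ 2 := by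
    rw [norm_div, norm_pow, norm_one, Complex.norm_real, Real.norm_eq_abs, sq_abs]
  have hν : 0 ≤ 1 / ε ^ 2 := by positivity
  have hb := norm_nonneg z
  have hνb := mul_nonneg hν hb
  have h1 : ‖z‖ ≤ y := by linarith
  have h2 : 1 / ε ^ 2 * ‖z‖ ≤ y := by linarith
  have hy2 := sq_nonneg y
  have hy3 : 0 ≤ y ^ 3 := by positivity
  refine ⟨?_, ?_, ?_⟩
  · have h3 : ‖z ^ 3 - z‖ ≤ ‖z‖ ^ 3 + ‖z‖ := by
      rw [← norm_pow]; exact norm_sub_le _ _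
    have h4 : 1 / ε ^ 2 * ‖z‖ * ‖z‖ ^ 2 ≤ y * y ^ 2 :=
      mul_le_mul h2 (pow_le_pow_left₀ hb h1 2) (by positivity) hy
    have h5 := mul_le_mul_of_nonneg_left h3 hν
    rw [nonlin, norm_mul, hνnorm]
    linarith
  · have h3 : ‖3 * z ^ 2 - 1‖ ≤ 3 * ‖z‖ ^ 2 + 1 := by
      refine (norm_sub_le _ _).trans ?_
      rw [norm_mul, norm_pow, norm_one]
      simp
    have h4 : 1 / ε ^ 2 * ‖z‖ * ‖z‖ ≤ y * y := mul_le_mul h2 h1 hb hy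
    have h5 := mul_le_mul_of_nonneg_left h3 hν
    rw [deriv_nonlin, norm_mul, hνnorm]
    linarith
  · have h3 : ‖(6 : ℂ)‖ = 6 := by simp
    rw [deriv_deriv_nonlin, norm_mul, hνnorm, norm_mul, h3]
    linarith

/-- A solution of the scheme is given by Fourier coefficients with the properties collected in
`IsCoefSolution`. -/
theorem exists_isCoefSolution {ρ C₀ Γ : ℝ} {S : Finset (Fin d → ℤ)} {V : Set ((Fin d → ℝ) → ℂ)}
    (hS : ∀ u ∈ V, ∃ c, u = trig L S c) (hsub : ∀ u ∈ V, ∀ v ∈ V, u - v ∈ V)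
    {Φ : (Fin d → ℝ) → ℂ}
    (hinit : ∀ c, IsL2Proj L V Φ (trig L S c) → sob L S 4 c ≤ C₀)
    (henergy : ∀ c, sob L S 2 c ≤ C₀ → energy L ε (trig L S c) + 1 ≤ Γ)
    {K : ℕ} {t : ℕ → ℝ} (ht : IsMesh K t)
    (hr : ∀ n, 1 ≤ n → n ≤ K → 0 ≤ ratio t n ∧ ratio t n ≤ ρ)
    {φb φ : ℕ → (Fin d → ℝ) → ℂ} {γ ξ η : ℕ → ℝ}
    (h : IsSchemeSolution L ε V Φ K t φb φ γ ξ η) :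
    ∃ a c : ℕ → (Fin d → ℤ) → ℂ, (∀ n ≤ K, φb n = trig L S (a n)) ∧
      (∀ n ≤ K, φ n = trig L S (c n)) ∧ IsCoefSolution L ε ρ C₀ Γ S K t a c γ ξ η := by
  have hmem : ∀ n ≤ K, φb n ∈ V := fun n hn => by
    rcases Nat.eq_zero_or_pos n with rfl | hn1
    · exact h.init_proj.1
    · exact h.mem n hn1 hn
  have hex : ∀ n, ∃ c, n ≤ K → φb n = trig L S c := fun n => by
    by_cases hn : n ≤ K
    · obtain ⟨c, hc⟩ := hS _ (hmem n hn)
      exact ⟨c, fun _ => hc⟩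
    · exact ⟨0, fun h => absurd h hn⟩
  choose a ha using hex
  set c : ℕ → (Fin d → ℤ) → ℂ := fun n => if n = 0 then a 0 else η n • a n with hc_def
  have hcn : ∀ n, 1 ≤ n → n ≤ K → c n = η n • a n := fun n hn _ => by
    simp only [hc_def, if_neg (show n ≠ 0 by omega)]
  have hc : ∀ n ≤ K, φ n = trig L S (c n) := fun n hn => by
    rcases Nat.eq_zero_or_pos n with rfl | hn1
    · rw [h.init_eq, ha 0 hn]; simp [hc_def]
    · rw [h.phi_eq n hn1 hn, ha n hn, hcn n hn1 hn, trig_smul]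
  have h0 : φb 0 = trig L S (a 0) := ha 0 (Nat.zero_le K)
  have hsob : sob L S 4 (a 0) ≤ C₀ := hinit _ (h0 ▸ h.init_proj)
  have hγ0 : γ 0 = energy L ε (trig L S (a 0)) + 1 := by rw [h.init_energy, h.init_eq, h0]
  have hstep : ∀ n, 1 ≤ n → n ≤ K → 0 < step t n := fun n hn hnK => by
    have := ht.2 (n - 1) (by omega)
    rw [Nat.sub_add_cancel hn] at this
    exact sub_pos.2 this
  refine ⟨a, c, ha, hc, ht.1, hstep, fun n h1 h2 => (hr n h1 h2).1, fun n h1 h2 => (hr n h1 h2).2,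
    by simp [hc_def], hsob, ?_, ?_, hcn, fun n h1 h2 => ?_, fun n h1 h2 => ?_, h.eta_eq,
    fun n h1 h2 => ?_⟩
  · rw [hγ0]; linarith [energy_nonneg L ε (trig L S (a 0))]
  · rw [hγ0]; exact henergy _ ((sob_mono (by norm_num) _).trans hsob)
  · have := h.aux n h1 h2
    rw [ha n h2, extrap_eq_trig hc h1 h2] at this
    exact this
  · rw [h.xi_eq n h1 h2, ha n h2]
  · have hw : φb n - φb (n - 1) = trig L S (a n - a (n - 1)) := by
      rw [trig_sub, ha n h2, ha (n - 1) (by omega)]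
    -- The increment is admissible as a test function because the trial space is closed under
    -- differences.
    have := h.evolution n h1 h2 _ (hsub _ (hmem n h2) _ (hmem (n - 1) (by omega)))
    rw [hw, bdf2_eq t _ h1, ha n h2, ha (n - 1) (by omega), ha (n - 1 - 1) (by omega),
      extrap_eq_trig hc h1 h2] at this
    rw [bdf2_eq t _ h1]
    exact this

end Main

end CahnHilliard

end

theorem corollary3p1 (d : ℕ) (hd : d = 2 ∨ d = 3) (L ε δ : ℝ) (hL : 0 < L) (hε : 0 < ε)
    (hδ : 0 < δ) (Φ0 : (Fin d → ℝ) → ℝ)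
    (hΦ0 : CahnHilliard.MemHper 4 L (fun x => (Φ0 x : ℂ))) :
    ∃ M₀ M : ℝ → ℝ,
      ∀ (N : ℕ) (_ : 2 ≤ N) (V : Set ((Fin d → ℝ) → ℂ))
        (_ : V = (CahnHilliard.fourierSpace d N L : Set ((Fin d → ℝ) → ℂ)) ∨
          V = CahnHilliard.realFourierSpace d N L)
        (K : ℕ) (t : ℕ → ℝ) (_ : CahnHilliard.IsMesh K t)
        (_ : CahnHilliard.RatioCondition δ K t)
        (φb φ : ℕ → (Fin d → ℝ) → ℂ) (γ ξ η : ℕ → ℝ)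
        (_ : CahnHilliard.IsSchemeSolution L ε V (fun x => (Φ0 x : ℂ)) K t φb φ γ ξ η)
        (n : ℕ) (_ : 1 ≤ n) (_ : n ≤ K),
        CahnHilliard.normH2 L (φb n) ≤ M₀ (t n) ∧
        CahnHilliard.normH2 L (φ n) = CahnHilliard.normH2 L (η n • φb n) ∧
        CahnHilliard.normH2 L (φ n) ≤ γ 0 * (2 + γ 0) * M₀ (t n) ∧
        γ 0 * (2 + γ 0) * M₀ (t n) ≤ M (t n) ∧
        CahnHilliard.normLinf L (fun x =>
            CahnHilliard.nonlin ε (CahnHilliard.extrap t φ n x)) ≤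
          ENNReal.ofReal (CahnHilliard.gBar (γ 0 * (2 + γ 0) * M₀ (t n))) ∧
        CahnHilliard.normLinf L (fun x =>
            deriv (CahnHilliard.nonlin ε) (CahnHilliard.extrap t φ n x)) ≤
          ENNReal.ofReal (CahnHilliard.gBar (γ 0 * (2 + γ 0) * M₀ (t n))) ∧
        CahnHilliard.normLinf L (fun x =>
            deriv (deriv (CahnHilliard.nonlin ε)) (CahnHilliard.extrap t φ n x)) ≤
          ENNReal.ofReal (CahnHilliard.gBar (γ 0 * (2 + γ 0) * M₀ (t n))) := by
  open CahnHilliard in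
  have hd0 : 0 < d := by omega
  have hd4 : d < 4 := by omega
  have h4 := four_le_rMax
  obtain ⟨C₀, hC₀, hinit⟩ := exists_sob_four_le hd0 hL hΦ0
  obtain ⟨CE, hCE⟩ := exists_energy_le (M := C₀) hd4 hL ε
  obtain ⟨A, hA, hsup⟩ := exists_sq_sum_norm_le_sob_two hd4 hL
  -- `Γ` bounds `γ⁰` uniformly in the trial space. The maximum with 0 in `ρ` covers the ratio `r₁ =
  -- 0` and the case `δ > r_max`.
  set Γ := max (CE + 1) 1 with hΓ
  set ρ := max (rMax - δ) 0 with hρ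
  have hρr : ρ < rMax := max_lt (by linarith) (by linarith)
  obtain ⟨R, hR0, hRmono, hR⟩ := exists_sob_two_le hd4 hL hε (le_max_right _ _ : 0 ≤ ρ) hρr hC₀
    (le_max_right _ _ : 1 ≤ Γ)
  set ν := 1 / ε ^ 2 with hν
  have hν0 : 0 < ν := by positivity
  -- The first root bounds the H² norm, the second the sup norm through the embedding constant `A`.
  -- The factor `1 + ν` and the summand `ν` give the two hypotheses of `norm_nonlin_bounds`.
  set M₀ : ℝ → ℝ := fun s => (1 + ν) * (Real.sqrt (L ^ d * R s) + Real.sqrt (A * R s)) + ν with hM₀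
  refine ⟨M₀, fun s => Γ * (2 + Γ) * M₀ s, ?_⟩
  intro N hN V hV K t ht hratio φb φ γ ξ η hsol n hn1 hn
  have hder : ∀ i, ∀ v ∈ V, pderiv i v ∈ V := by
    rcases hV with rfl | rfl
    · exact fun i v hv => pderiv_mem_fourierSpace i hv
    · exact fun i v hv => pderiv_mem_realFourierSpace i hv
  have hsub : ∀ u ∈ V, ∀ v ∈ V, u - v ∈ V := by
    rcases hV with rfl | rfl
    · exact fun u hu v hv => Submodule.sub_mem _ hu hv
    · exact fun u hu v hv => sub_mem_realFourierSpace hu hv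
  have hVF : ∀ u ∈ V, u ∈ fourierSpace d N L := by
    rcases hV with rfl | rfl
    · exact fun u hu => hu
    · exact fun u hu => hu.1
  obtain ⟨S, hS⟩ := exists_trig_of_mem_fourierSpace d N L
  have hr : ∀ n, 1 ≤ n → n ≤ K → 0 ≤ ratio t n ∧ ratio t n ≤ ρ := fun m hm1 hm => by
    rcases hm1.eq_or_lt with rfl | hm2
    · simp [ratio, hρ]
    · obtain ⟨h1, h2⟩ := hratio m hm2 hm
      exact ⟨h1.le, h2.trans (le_max_left _ _)⟩
  obtain ⟨a, c, ha, hc, h⟩ := exists_isCoefSolution (fun u hu => hS u (hVF u hu)) hsub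
    (fun c hc => hinit V S c hder hc)
    (fun c hc => (add_le_add_left (hCE S c hc) 1).trans (le_max_left _ _)) ht hr hsol
  set G := γ 0 * (2 + γ 0) with hG
  have hγ1 := h.one_le_gamma
  have hγΓ := h.gamma_le
  have hG1 : 1 ≤ G := by nlinarith
  have ht0 := h.t_nonneg hn
  have hRn := hR0 _ ht0
  have hMnu : ν ≤ M₀ (t n) := by
    simp only [hM₀]
    have := Real.sqrt_nonneg (L ^ d * R (t n))
    have := Real.sqrt_nonneg (A * R (t n))
    have : 0 ≤ (1 + ν) * (Real.sqrt (L ^ d * R (t n)) + Real.sqrt (A * R (t n))) := by positivity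
    linarith
  have hMsup : (1 + ν) * Real.sqrt (A * R (t n)) ≤ M₀ (t n) := by
    simp only [hM₀]
    have : 0 ≤ (1 + ν) * Real.sqrt (L ^ d * R (t n)) := by positivity
    linarith
  have hM0 : 0 ≤ M₀ (t n) := hν0.le.trans hMnu
  have hH2 : normH2 L (φb n) ≤ M₀ (t n) := by
    rw [ha n hn]
    refine (normH2_trig_le hL _).trans ?_
    have h1 : Real.sqrt (L ^ d * sob L S 2 (a n)) ≤ Real.sqrt (L ^ d * R (t n)) :=
      Real.sqrt_le_sqrt (mul_le_mul_of_nonneg_left (hR S K t a c γ ξ η h n hn)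
        (pow_pos hL d).le)
    have h2 := Real.sqrt_nonneg (L ^ d * R (t n))
    have h3 := Real.sqrt_nonneg (A * R (t n))
    simp only [hM₀]
    nlinarith [mul_nonneg hν0.le h2, mul_nonneg hν0.le h3]
  have hphi := hsol.phi_eq n hn1 hn
  -- The extrapolation involves earlier times, and monotonicity of `R` allows them all to be bounded
  -- at time `t n`.
  have hbound : ∀ j ≤ n, ∀ x, ‖trig L S (c j) x‖ ≤ G * Real.sqrt (A * R (t n)) := by
    intro j hj x
    obtain ⟨r, hr1, hr2⟩ := h.exists_coef_eq (hj.trans hn)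
    have h1 : ‖trig L S (a j) x‖ ≤ Real.sqrt (A * R (t n)) := by
      refine (norm_trig_le _ x).trans (Real.le_sqrt_of_sq_le ((hsup S _).trans ?_))
      refine mul_le_mul_of_nonneg_left ((hR S K t a c γ ξ η h j (hj.trans hn)).trans ?_)
        (by linarith)
      exact hRmono _ _ (h.t_nonneg (hj.trans hn)) (h.t_mono hj hn)
    rw [hr2, trig_smul, Pi.smul_apply, norm_smul, Real.norm_eq_abs]
    exact mul_le_mul hr1 h1 (norm_nonneg _) (by linarith)
  set y := (1 + 2 * rMax) * (G * M₀ (t n)) with hy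
  have hy0 : 0 ≤ y := by positivity
  have hext : ∀ x, (1 + ν) * ‖extrap t φ n x‖ ≤ y := by
    intro x
    rw [extrap_eq_trig hc hn1 hn, extrapCoef, trig_sub, trig_smul, trig_smul]
    obtain ⟨hr0, hrρ⟩ := hr n hn1 hn
    have h1 := hbound (n - 1) (by omega) x
    have h2 := hbound (n - 2) (by omega) x
    -- The coefficients of the extrapolation have absolute sum `1 + 2 rₙ`, which is the source of
    -- the factor `1 + 2 r_max`.
    have h3 : ‖((1 + ratio t n) • trig L S (c (n - 1)) - ratio t n • trig L S (c (n - 2))) x‖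
        ≤ (1 + 2 * rMax) * (G * Real.sqrt (A * R (t n))) := by
      rw [Pi.sub_apply, Pi.smul_apply, Pi.smul_apply]
      refine (norm_sub_le _ _).trans ?_
      rw [norm_smul, norm_smul, Real.norm_of_nonneg hr0, Real.norm_of_nonneg (by linarith)]
      have h4 : 0 ≤ G * Real.sqrt (A * R (t n)) := by positivity
      have h5 := mul_le_mul_of_nonneg_left h1 (by linarith : 0 ≤ 1 + ratio t n)
      have h6 := mul_le_mul_of_nonneg_left h2 hr0
      have h7 := mul_le_mul_of_nonneg_right (hrρ.trans hρr.le) h4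
      linarith
    calc _ ≤ (1 + ν) * ((1 + 2 * rMax) * (G * Real.sqrt (A * R (t n)))) :=
          mul_le_mul_of_nonneg_left h3 (by linarith)
      _ = (1 + 2 * rMax) * (G * ((1 + ν) * Real.sqrt (A * R (t n)))) := by ring
      _ ≤ y := by rw [hy]; gcongr
  have hνy : ν ≤ y := by
    have h1 : M₀ (t n) ≤ G * M₀ (t n) := le_mul_of_one_le_left hM0 hG1
    have h2 : G * M₀ (t n) ≤ y := le_mul_of_one_le_left (by positivity) (by linarith)
    linarith
  refine ⟨hH2, by rw [hphi], ?_, ?_, ?_, ?_, ?_⟩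
  · rw [hphi, ha n hn, normH2_smul_trig hL, ← ha n hn]
    exact mul_le_mul (h.abs_eta_le hn1 hn) hH2 (Real.sqrt_nonneg _) (by linarith)
  · refine mul_le_mul_of_nonneg_right ?_ hM0
    rw [hG]
    gcongr
  · exact normLinf_le fun x => (norm_nonlin_bounds hy0 hνy (hext x)).1
  · exact normLinf_le fun x => (norm_nonlin_bounds hy0 hνy (hext x)).2.1
  · exact normLinf_le fun x => (norm_nonlin_bounds hy0 hνy (hext x)).2.2
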